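/- Conventions: manifolds are finite-dimensional, Hausdorff, second countable, without boundary and $C^\infty$. A Poisson bracket on a manifold $M$ is an $\mathbb R$-bilinear, skew-symmetric bracket on $C^\infty(M)$ satisfying the Leibniz rule and the Jacobi identity. For a symplectic form $\Omega$ on $A$, the Hamiltonian vector field $\mathcal H_f$ is defined by $i_{\mathcal H_f}\Omega=df$, and $\{f,g\}_A=\mathcal H_g(f)$. A cosymplectic structure on a manifold of dimension $2n+1$ is a pair $(\omega,\eta)$ of a closed $2$-form and a closed $1$-form such that $\eta\wedge\omega^n$ is a volume form; its Reeb vector field $\mathcal R$ is defined by $i_{\mathcal R}\omega=0$, $\eta(\mathcal R)=1$; the Hamiltonian vector field of $f$ is defined by $i_{\mathcal H_f}\omega=df-\mathcal R(f)\eta$, $\eta(\mathcal H_f)=0$; and the associated Poisson bracket is $\{f,g\}=\mathcal H_g(f)$. Let $\mu:(A,\Omega)\to V$ be a symplectic principal $\mathbb R$-bundle, that is, a smooth principal $\mathbb R$-bundle $\mu:A\to V$ with principal action $\psi:\mathbb R\times A\to A$, together with a symplectic form $\Omega$ on $A$ such that $\psi_s^*\Omega=\Omega$ for all $s\in\mathbb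 R$. Let $Z_\mu$ be the infinitesimal generator of $\psi$. **Proposition.** There is a unique Poisson bracket $\{\cdot,\cdot\}_V$ on $V$ such that $\mu$ is a Poisson map, i.e. $\{f\circ\mu,g\circ\mu\}_A=\{f,g\}_V\circ\mu$ for all $f,g\in C^\infty(V)$. For every Hamiltonian section $h$ of $\mu$ (a smooth map $h:V\to A$ with $\mu\circ h=\mathrm{id}_V$), the pair $$\omega_h=h^*\Omega,\qquad \eta_h=-h^*(i_{Z_\mu}\Omega)$$ is a cosymplectic structure on $V$, it has an associated Poisson bracket $\{\cdot,\cdot\}_h$ on $V$, and $$\{\cdot,\cdot\}_h=\{\cdot,\cdot\}_V .$$ In particular, $\{\cdot,\cdot\}_h$ does not depend on $h$. -/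

import Mathlib

open scoped Manifold ContDiff

noncomputable section

namespace RBundle

/-! ### Differential forms

All manifolds are real, finite-dimensional, without boundary and of class `C^∞`; `E` is the model
vector space of the manifold `M`. The tangent space `TangentSpace 𝓘(ℝ, E) x` of `M` at `x` is by
definition the vector space `E` (a tangent vector is written in the preferred chart at `x`), and
`mfderiv` takes the tangent vectors of source and target in this form. Tangent vectors at `x`,
forms on the tangent space at `x` and vector fields are therefore typed by `E`. -/

section Forms

variable {E : Type*} [NormedAddCommGroup E] [NormedSpace ℝ E]
  {M : Type*} [TopologicalSpace M] [ChartedSpace E M]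
  {E' : Type*} [NormedAddCommGroup E'] [NormedSpace ℝ E']
  {N : Type*} [TopologicalSpace N] [ChartedSpace E' N]

variable (E M) in
/-- A (not necessarily smooth) differential `k`-form on `M`: an alternating `k`-linear form on each
tangent space `T_x M = E`. -/
abbrev DiffForm (k : ℕ) : Type _ :=
  M → E [⋀^Fin k]→L[ℝ] ℝ

variable (E M) in
/-- A (not necessarily smooth) vector field on `M`. -/
abbrev VField : Type _ := M → E

/-- The derivative `T_x f : T_x M → T_{f(x)} N` of a map of manifolds. -/
def tangentMapAt (f : M → N) (x : M) : E →L[ℝ] E' := mfderiv 𝓘(ℝ, E) 𝓘(ℝ, E') f x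

/-- The local representative of a form in the preferred chart `φ` at `x₀`: the pullback of the form
by `φ⁻¹`. It is meaningful on the target of the chart, an open subset of `E`. -/
def DiffForm.chartRep {k : ℕ} (α : DiffForm E M k) (x₀ : M) : E → E [⋀^Fin k]→L[ℝ] ℝ :=
  fun y => (α ((extChartAt 𝓘(ℝ, E) x₀).symm y)).compContinuousLinearMap
    (tangentMapAt (M := E) (N := M) (extChartAt 𝓘(ℝ, E) x₀).symm y)

/-- A form is smooth if its local representatives are `C^∞`. -/
def DiffForm.IsSmooth {k : ℕ} (α : DiffForm E M k) : Prop :=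
  ∀ x₀ : M, ContDiffOn ℝ ∞ (α.chartRep x₀) (extChartAt 𝓘(ℝ, E) x₀).target

/-- A form is closed if the exterior derivatives of its local representatives vanish. -/
def DiffForm.IsClosed {k : ℕ} (α : DiffForm E M k) : Prop :=
  ∀ x₀ : M, ∀ y ∈ (extChartAt 𝓘(ℝ, E) x₀).target, extDeriv (α.chartRep x₀) y = 0

/-- The pullback `f^* α` of a form by a map `f : M → N`. -/
def DiffForm.pullback {k : ℕ} (f : M → N) (α : DiffForm E' N k) : DiffForm E M k :=
  fun x => (α (f x)).compContinuousLinearMap (tangentMapAt f x)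

/-- The interior product `i_Z α`, that is `(i_Z α)(v₁, …, v_k) = α(Z, v₁, …, v_k)`. -/
def DiffForm.interior {k : ℕ} (Z : VField E M) (α : DiffForm E M (k + 1)) : DiffForm E M k :=
  fun x => (α x).curryLeft (Z x)

/-- The differential `df`, evaluated on the tangent vector `v` at `x`. -/
def dFun (f : M → ℝ) (x : M) (v : E) : ℝ :=
  tangentMapAt f x v

/-! ### Symplectic structures -/

/-- A symplectic form: a smooth closed nondegenerate `2`-form. -/
structure IsSymplectic (Ω : DiffForm E M 2) : Prop where
  smooth : Ω.IsSmooth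
  closed : Ω.IsClosed
  nondegenerate : ∀ (x : M) (v : E), (∀ w, Ω x ![v, w] = 0) → v = 0

/-- The Hamiltonian vector field `H_f` of `f` for the symplectic form `Ω`: at every point it is the
(unique) solution of `i_{H_f} Ω = df`. -/
def hamiltonianField (Ω : DiffForm E M 2) (f : M → ℝ) : VField E M :=
  fun x => Classical.epsilon fun X : E => ∀ w, Ω x ![X, w] = dFun f x w

/-- The Poisson bracket `{f, g} = H_g(f)` of a symplectic form. -/
def symplecticBracket (Ω : DiffForm E M 2) (f g : M → ℝ) : M → ℝ :=
  fun x => dFun f x (hamiltonianField Ω g x)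

/-! ### Cosymplectic structures -/

/-- The value on `v₀, …, v_{2n}` of the `(2n+1)`-form `η ∧ α ∧ … ∧ α` (`n` factors `α`), by the
usual formula for the wedge product of a `1`-form and `n` two-forms. -/
def etaWedgeOmegaPow (α : DiffForm E M 2) (η : DiffForm E M 1) (n : ℕ) (x : M)
    (v : Fin (2 * n + 1) → E) : ℝ :=
  (1 / 2 ^ n : ℝ) * ∑ σ : Equiv.Perm (Fin (2 * n + 1)), ((Equiv.Perm.sign σ : ℤ) : ℝ) *
    (η x ![v (σ 0)] *
      ∏ i : Fin n, α x ![v (σ ⟨2 * i + 1, by omega⟩), v (σ ⟨2 * i + 2, by omega⟩)])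

/-- A cosymplectic structure on `M`: a smooth closed `2`-form `α` and a smooth closed `1`-form `η`
such that `dim M = 2n + 1` and `η ∧ α^n` is a volume form. -/
structure IsCosymplectic (α : DiffForm E M 2) (η : DiffForm E M 1) : Prop where
  smooth_two : α.IsSmooth
  closed_two : α.IsClosed
  smooth_one : η.IsSmooth
  closed_one : η.IsClosed
  volume : ∀ x : M, ∃ n : ℕ, Module.finrank ℝ E = 2 * n + 1 ∧
    ∃ v, etaWedgeOmegaPow α η n x v ≠ 0

/-- The Reeb vector field `R` of a cosymplectic structure: at every point the (unique) solution of
`i_R α = 0`, `η(R) = 1`. -/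
def reebField (α : DiffForm E M 2) (η : DiffForm E M 1) : VField E M :=
  fun x => Classical.epsilon fun R : E =>
    (∀ w, α x ![R, w] = 0) ∧ η x ![R] = 1

/-- The Hamiltonian vector field `H_f` of `f` for a cosymplectic structure: at every point the
(unique) solution of `i_{H_f} α = df - R(f) η`, `η(H_f) = 0`. -/
def cosymplecticHamiltonianField (α : DiffForm E M 2) (η : DiffForm E M 1) (f : M → ℝ) :
    VField E M :=
  fun x => Classical.epsilon fun X : E =>
    (∀ w, α x ![X, w] = dFun f x w - dFun f x (reebField α η x) * η x ![w]) ∧ η x ![X] = 0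

/-- The Poisson bracket `{f, g} = H_g(f)` of a cosymplectic structure. -/
def cosymplecticBracket (α : DiffForm E M 2) (η : DiffForm E M 1) (f g : M → ℝ) : M → ℝ :=
  fun x => dFun f x (cosymplecticHamiltonianField α η g x)

/-! ### Poisson structures -/

variable (E M) in
/-- A Poisson structure on `M`: a bilinear bracket on `C^∞(M)` which is skew-symmetric, satisfies
the Leibniz rule and the Jacobi identity. -/
@[ext]
structure PoissonBracket where
  bracket : C^∞⟮𝓘(ℝ, E), M; ℝ⟯ →ₗ[ℝ] C^∞⟮𝓘(ℝ, E), M; ℝ⟯ →ₗ[ℝ] C^∞⟮𝓘(ℝ, E), M; ℝ⟯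
  skew : ∀ f g, bracket f g = -bracket g f
  leibniz : ∀ f g k, bracket f (g * k) = bracket f g * k + g * bracket f k
  jacobi : ∀ f g k,
    bracket f (bracket g k) + bracket g (bracket k f) + bracket k (bracket f g) = 0

/-- `B` is the Poisson bracket associated with the cosymplectic structure `(α, η)`. -/
def IsCosymplecticPoisson (α : DiffForm E M 2) (η : DiffForm E M 1) (B : PoissonBracket E M) :
    Prop :=
  ∀ (f g : C^∞⟮𝓘(ℝ, E), M; ℝ⟯) (x : M), B.bracket f g x = cosymplecticBracket α η f g x

end Forms

/-! ### Symplectic principal `ℝ`-bundles -/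

section Bundles

variable {E : Type*} [NormedAddCommGroup E] [NormedSpace ℝ E]
  {A : Type*} [TopologicalSpace A] [ChartedSpace E A]
  {E' : Type*} [NormedAddCommGroup E'] [NormedSpace ℝ E']
  {V : Type*} [TopologicalSpace V] [ChartedSpace E' V]

variable (E E') in
/-- `μ : A → V` is a smooth principal `ℝ`-bundle with principal action `ψ`: `ψ` is a smooth action
of `(ℝ, +)` on `A` preserving the fibres of `μ`, and around every point of `V` there is a smooth
`ℝ`-equivariant local trivialization `μ⁻¹(U) ≃ U × ℝ` over `U` (so that `ψ` is free and its orbits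
are the fibres of the surjective submersion `μ`). -/
structure IsPrincipalRBundle (ψ : ℝ → A → A) (μ : A → V) : Prop where
  smooth_proj : ContMDiff 𝓘(ℝ, E) 𝓘(ℝ, E') ∞ μ
  smooth_action : ContMDiff (𝓘(ℝ, ℝ).prod 𝓘(ℝ, E)) 𝓘(ℝ, E) ∞ fun p : ℝ × A => ψ p.1 p.2
  zero_action : ∀ a, ψ 0 a = a
  add_action : ∀ s t a, ψ (s + t) a = ψ s (ψ t a)
  proj_action : ∀ s a, μ (ψ s a) = μ a
  locally_trivial : ∀ v : V, ∃ e : Bundle.Trivialization ℝ μ, v ∈ e.baseSet ∧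
    ContMDiffOn 𝓘(ℝ, E) (𝓘(ℝ, E').prod 𝓘(ℝ, ℝ)) ∞ e e.source ∧
    ContMDiffOn (𝓘(ℝ, E').prod 𝓘(ℝ, ℝ)) 𝓘(ℝ, E) ∞ e.toOpenPartialHomeomorph.symm e.target ∧
    ∀ a ∈ e.source, ∀ s : ℝ, (e (ψ s a)).2 = s + (e a).2

/-- A symplectic principal `ℝ`-bundle `μ : (A, Ω) → V`: the principal action `ψ` preserves the
symplectic form `Ω`. -/
structure IsSymplecticPrincipalRBundle (Ω : DiffForm E A 2) (ψ : ℝ → A → A) (μ : A → V) :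
    Prop where
  principal : IsPrincipalRBundle E E' ψ μ
  symplectic : IsSymplectic Ω
  action_symplectic : ∀ s : ℝ, Ω.pullback (ψ s) = Ω

/-- The infinitesimal generator `Z_μ(a) = d/ds|_{s = 0} ψ(s, a)` of the principal action
(here `ψ 0 a = a`). -/
def infGenerator (ψ : ℝ → A → A) : VField E A :=
  fun a => tangentMapAt (fun s : ℝ => ψ s a) (0 : ℝ) (1 : ℝ)

/-- `B` is the Poisson structure on the base `V` induced by the symplectic principal `ℝ`-bundle:
`μ` is a Poisson map, that is `{f ∘ μ, g ∘ μ}_A = {f, g} ∘ μ`. -/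
def IsInducedPoisson (Ω : DiffForm E A 2) (μ : A → V) (B : PoissonBracket E' V) : Prop :=
  ∀ (f g : C^∞⟮𝓘(ℝ, E'), V; ℝ⟯) (a : A),
    symplecticBracket Ω (f ∘ μ) (g ∘ μ) a = B.bracket f g (μ a)

variable (E E') in
/-- A Hamiltonian section: a smooth map `h : V → A` with `μ ∘ h = id`. -/
structure IsHamiltonianSection (μ : A → V) (h : V → A) : Prop where
  smooth : ContMDiff 𝓘(ℝ, E') 𝓘(ℝ, E) ∞ h
  section_eq : ∀ v, μ (h v) = v

/-- The `2`-form `ω_h = h^* Ω` on `V`. -/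
def omegaH (Ω : DiffForm E A 2) (h : V → A) : DiffForm E' V 2 := Ω.pullback h

/-- The `1`-form `η_h = -h^*(i_{Z_μ} Ω)` on `V`. -/
def etaH (Ω : DiffForm E A 2) (ψ : ℝ → A → A) (h : V → A) : DiffForm E' V 1 :=
  -(Ω.interior (infGenerator ψ)).pullback h

end Bundles

end RBundle

end

/-! The proof works in charts adapted to the action. A local section `σ` of `μ`, read in a chart of
`V`, gives a parametrization `G(y, s) = ψ_s(σ(y))` of `A` (`flowOut`), whose tangent maps are
bijective. The pulled-back form `Θ = G^*Ω` (`modelForm`) is symplectic on `O × ℝ` and, since `ψ`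
preserves `Ω`, independent of `s`; functions `f ∘ μ` become functions of `y` alone (`baseRep`).
Their bracket is therefore independent of `s`, hence constant on the fibres, which are the orbits,
and it descends to `V`. Smoothness and the Jacobi identity are read off from `Θ`: on an open set of
a vector space the Jacobi sum is `dΘ` evaluated on three Hamiltonian fields (`localBracket_jacobi`).
Uniqueness is the surjectivity of `μ`.

For a Hamiltonian section `h`, the space `T_{h(x)}A` is the direct sum of the image of `T_x h` and
the line of `Z_μ` (`bijective_tangent`), and in this splitting `Ω(u + aZ, w + bZ) = ω_h(u, w) - a
η_h(w) + b η_h(u)` (`tangent_sum_apply`). Nondegeneracy of `Ω` thus becomes nondegeneracy of the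
pair `(ω_h, η_h)`, which yields the Reeb vector and, through a symplectic basis of `ker η_h`, the
volume condition (`exists_volume`). Closedness of `ω_h` is naturality of `d`; closedness of `η_h`
also uses the invariance of `Θ`.

The brackets agree because, if `ω_h(u, ·) - a η_h = dg` and `η_h(u) = 0`, then `u` is the
cosymplectic Hamiltonian vector of `g` (with `a = -R(g)`), while the displayed formula makes `T h(u)
+ aZ` the symplectic Hamiltonian vector of `g ∘ μ`. The term `aZ` is vertical, so both give the same
derivative of `f` (`cosymplecticBracket_eq`). -/

noncomputable section

namespace RBundle

/-! ### Smooth families of alternating forms -/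

section Calculus

variable {W : Type*} [NormedAddCommGroup W] [NormedSpace ℝ W]
  {E : Type*} [NormedAddCommGroup E] [NormedSpace ℝ E] [FiniteDimensional ℝ E]

/-- A family of alternating forms on a finite-dimensional space is smooth as soon as all its
evaluations on fixed vectors are. -/
theorem contDiffOn_alternating_of_apply {k : ℕ} {n : WithTop ℕ∞} {s : Set W}
    {f : W → E [⋀^Fin k]→L[ℝ] ℝ} (h : ∀ v, ContDiffOn ℝ n (fun p => f p v) s) :
    ContDiffOn ℝ n f s := by
  classical
  let b := Module.finBasis ℝ E
  let Φ : (E [⋀^Fin k]→L[ℝ] ℝ) →ₗ[ℝ] ((Fin k → Fin (Module.finrank ℝ E)) → ℝ) :=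
    { toFun := fun α r => α (fun i => b (r i))
      map_add' := fun _ _ => rfl
      map_smul' := fun _ _ => rfl }
  have hΦ : LinearMap.ker Φ = ⊥ := by
    rw [LinearMap.ker_eq_bot']
    intro α hα
    apply ContinuousAlternatingMap.toAlternatingMap_injective
    apply Module.Basis.ext_alternating b
    intro r _
    exact congrFun hα r
  -- A linear left inverse recovers the form from its values on tuples of basis vectors; finite
  -- dimension makes it continuous, hence smooth.
  obtain ⟨Ψ, hΨ⟩ := Φ.exists_leftInverse_of_injective hΦ
  have : f = fun p => LinearMap.toContinuousLinearMap Ψ (Φ (f p)) := by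
    funext p
    exact (LinearMap.congr_fun hΨ (f p)).symm
  rw [this]
  exact (LinearMap.toContinuousLinearMap Ψ).contDiff.comp_contDiffOn
    (contDiffOn_pi.2 fun r => h _)

theorem ContDiffOn.alternating_apply {k : ℕ} {n : WithTop ℕ∞} {s : Set W}
    {f : W → E [⋀^Fin k]→L[ℝ] ℝ} {u : Fin k → W → E} (hf : ContDiffOn ℝ n f s)
    (hu : ∀ i, ContDiffOn ℝ n (u i) s) : ContDiffOn ℝ n (fun p => f p fun i => u i p) s := by
  classical
  let b := Module.finBasis ℝ E
  have key : (fun p => f p fun i => u i p) = fun p =>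
      ∑ r : Fin k → Fin (Module.finrank ℝ E),
        (∏ i, LinearMap.toContinuousLinearMap (b.coord (r i)) (u i p)) *
          f p (fun i => b (r i)) := by
    funext p
    have h1 : (fun i => u i p) = fun i => ∑ j, b.repr (u i p) j • b j := by
      funext i
      exact (b.sum_repr _).symm
    rw [h1]
    change (f p).toMultilinearMap _ = _
    rw [MultilinearMap.map_sum]
    refine Finset.sum_congr rfl fun r _ => ?_
    rw [MultilinearMap.map_smul_univ]
    rfl
  rw [key]
  refine ContDiffOn.sum fun r _ => ContDiffOn.mul (contDiffOn_prod fun i _ => ?_) ?_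
  · exact (LinearMap.toContinuousLinearMap (b.coord (r i))).contDiff.comp_contDiffOn (hu i)
  · exact (ContinuousAlternatingMap.apply ℝ E ℝ (fun i => b (r i))).contDiff.comp_contDiffOn hf

end Calculus

/-! ### Pullback of forms from a manifold to a vector space -/

section Pullback

variable {W : Type*} [NormedAddCommGroup W] [NormedSpace ℝ W]
  {E : Type*} [NormedAddCommGroup E] [NormedSpace ℝ E]
  {M : Type*} [TopologicalSpace M] [ChartedSpace E M] [IsManifold 𝓘(ℝ, E) ∞ M]

/-- Near `p₀`, the pullback of a form on `M` by `G : W → M` is the pullback of its local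
representative at `G p₀` by the local expression of `G`. -/
theorem pullback_eventuallyEq {k : ℕ} (α : DiffForm E M k) {O : Set W} (hO : IsOpen O) {G : W → M}
    (hG : ContMDiffOn 𝓘(ℝ, W) 𝓘(ℝ, E) ∞ G O) {p₀ : W} (hp₀ : p₀ ∈ O) :
    ∃ U : Set W, IsOpen U ∧ p₀ ∈ U ∧ U ⊆ O ∧
      ContDiffOn ℝ ∞ (fun p => extChartAt 𝓘(ℝ, E) (G p₀) (G p)) U ∧
      (∀ p ∈ U, extChartAt 𝓘(ℝ, E) (G p₀) (G p) ∈ (extChartAt 𝓘(ℝ, E) (G p₀)).target) ∧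
      ∀ p ∈ U, DiffForm.pullback (E := W) G α p =
        (α.chartRep (G p₀) (extChartAt 𝓘(ℝ, E) (G p₀) (G p))).compContinuousLinearMap
          (fderiv ℝ (fun p => extChartAt 𝓘(ℝ, E) (G p₀) (G p)) p) := by
  set x₀ := G p₀
  set χ := extChartAt 𝓘(ℝ, E) x₀ with hχ
  have hU : IsOpen (O ∩ G ⁻¹' χ.source) :=
    hG.continuousOn.isOpen_inter_preimage hO (isOpen_extChartAt_source x₀)
  have hsm : ContDiffOn ℝ ∞ (fun p => χ (G p)) (O ∩ G ⁻¹' χ.source) := by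
    rw [← contMDiffOn_iff_contDiffOn]
    refine ContMDiffOn.comp (t := χ.source) ?_ (hG.mono Set.inter_subset_left)
      Set.inter_subset_right
    rw [hχ, extChartAt_source]
    exact contMDiffOn_extChartAt
  refine ⟨_, hU, ⟨hp₀, mem_extChartAt_source x₀⟩, Set.inter_subset_left, hsm,
    fun p hp => χ.map_source hp.2, fun p hp => ?_⟩
  have h1 : MDifferentiableAt 𝓘(ℝ, E) 𝓘(ℝ, E) χ.symm (χ (G p)) :=
    ((contMDiffOn_extChartAt_symm (n := ∞) x₀).contMDiffAt
      ((isOpen_extChartAt_target x₀).mem_nhds (χ.map_source hp.2))).mdifferentiableAt (by simp)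
  have h2 : MDifferentiableAt 𝓘(ℝ, W) 𝓘(ℝ, E) (fun p => χ (G p)) p :=
    ((hsm.contDiffAt (hU.mem_nhds hp)).differentiableAt (by simp)).mdifferentiableAt
  have h3 : tangentMapAt (E := W) (E' := E) G p = (tangentMapAt (M := E) (N := M) χ.symm
      (χ (G p))).comp (fderiv ℝ (fun p => χ (G p)) p) := by
    have := mfderiv_comp p h1 h2
    rw [mfderiv_eq_fderiv] at this
    refine Eq.trans ?_ this
    apply Filter.EventuallyEq.mfderiv_eq
    filter_upwards [hU.mem_nhds hp] with q hq
    exact (χ.left_inv hq.2).symm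
  unfold DiffForm.pullback DiffForm.chartRep
  rw [h3]
  rw [← hχ, χ.left_inv hp.2]
  rfl

theorem DiffForm.IsSmooth.pullback [FiniteDimensional ℝ W] [FiniteDimensional ℝ E] {k : ℕ}
    {α : DiffForm E M k} (hα : α.IsSmooth)
    {O : Set W} (hO : IsOpen O) {G : W → M} (hG : ContMDiffOn 𝓘(ℝ, W) 𝓘(ℝ, E) ∞ G O) :
    ContDiffOn ℝ ∞ (DiffForm.pullback (E := W) G α) O := by
  intro p₀ hp₀
  obtain ⟨U, hU, hpU, -, hsm, hmem, heq⟩ := pullback_eventuallyEq α hO hG hp₀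
  have : ContDiffOn ℝ ∞ (DiffForm.pullback (E := W) G α) U := by
    refine ContDiffOn.congr ?_ heq
    refine contDiffOn_alternating_of_apply fun v => ?_
    refine ContDiffOn.alternating_apply
      (f := fun p => α.chartRep (G p₀) (extChartAt 𝓘(ℝ, E) (G p₀) (G p)))
      (u := fun i p => fderiv ℝ (fun p => extChartAt 𝓘(ℝ, E) (G p₀) (G p)) p (v i))
      ((hα (G p₀)).comp hsm hmem) fun i => ?_
    exact ContDiffOn.clm_apply (hsm.fderiv_of_isOpen hU (by simp)) contDiffOn_const
  exact (this.contDiffAt (hU.mem_nhds hpU)).contDiffWithinAt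

/-- Near `p` the pullback factors through the local representative in the chart at `G p`, and `d`
commutes with pullback between vector spaces. -/
theorem DiffForm.IsClosed.pullback {k : ℕ} {α : DiffForm E M k} (hα : α.IsClosed)
    (hs : α.IsSmooth) {O : Set W} (hO : IsOpen O) {G : W → M}
    (hG : ContMDiffOn 𝓘(ℝ, W) 𝓘(ℝ, E) ∞ G O) {p : W} (hp : p ∈ O) :
    extDeriv (DiffForm.pullback (E := W) G α) p = 0 := by
  obtain ⟨U, hU, hpU, -, hsm, hmem, heq⟩ := pullback_eventuallyEq α hO hG hp
  have h1 : DiffForm.pullback (E := W) G α =ᶠ[nhds p] _ :=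
    Filter.eventuallyEq_of_mem (hU.mem_nhds hpU) heq
  rw [h1.extDeriv_eq]
  rw [extDeriv_pullback (r := ∞) (f := fun p' => extChartAt 𝓘(ℝ, E) (G p) (G p')) ?_
    (hsm.contDiffAt (hU.mem_nhds hpU)) (by
      rw [minSmoothness_of_isRCLikeNormedField]
      exact WithTop.coe_le_coe.2 le_top)]
  · rw [hα _ _ (hmem p hpU)]
    rfl
  · exact ((hs (G p)).contDiffAt ((isOpen_extChartAt_target (G p)).mem_nhds
      (hmem p hpU))).differentiableAt (by simp)

end Pullback

/-! ### Linear algebra of a 2-form -/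

section Flat

variable {W : Type*} [NormedAddCommGroup W] [NormedSpace ℝ W]

/-- The linear map `v ↦ α(v, ·)` of an alternating `2`-form. -/
def flat (α : W [⋀^Fin 2]→L[ℝ] ℝ) : W →L[ℝ] W →L[ℝ] ℝ :=
  ((ContinuousAlternatingMap.ofSubsingletonLIE (𝕜 := ℝ) (E := W) (F := ℝ) (0 : Fin 1)).symm :
    (W [⋀^Fin 1]→L[ℝ] ℝ) →L[ℝ] W →L[ℝ] ℝ).comp α.curryLeft

@[simp]
theorem flat_apply (α : W [⋀^Fin 2]→L[ℝ] ℝ) (v w : W) : flat α v w = α ![v, w] := by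
  change α (Matrix.vecCons v fun _ => w) = _
  congr 1
  ext i
  fin_cases i <;> rfl

theorem flat_skew (α : W [⋀^Fin 2]→L[ℝ] ℝ) (v w : W) : α ![v, w] = -α ![w, v] := by
  have := α.map_swap ![w, v] (i := 0) (j := 1) (by decide)
  refine Eq.trans ?_ this
  change α _ = α _
  congr 1
  ext i
  fin_cases i <;> rfl

theorem flat_self (α : W [⋀^Fin 2]→L[ℝ] ℝ) (v : W) : α ![v, v] = 0 := by
  have := flat_skew α v v
  linarith

/-- Injectivity suffices, because a space and its dual have the same dimension. In this form
`ContinuousLinearMap.inverse` and its smoothness at equivalences become available. -/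
theorem exists_equiv_eq_flat [FiniteDimensional ℝ W] {α : W [⋀^Fin 2]→L[ℝ] ℝ}
    (h : ∀ v, (∀ w, α ![v, w] = 0) → v = 0) :
    ∃ e : W ≃L[ℝ] (W →L[ℝ] ℝ), (e : W →L[ℝ] W →L[ℝ] ℝ) = flat α := by
  have hinj : Function.Injective (flat α : W →ₗ[ℝ] W →L[ℝ] ℝ) := by
    rw [injective_iff_map_eq_zero]
    intro v hv
    refine h v fun w => ?_
    rw [← flat_apply]
    exact congrArg (fun l : W →L[ℝ] ℝ => l w) hv
  have hdim : Module.finrank ℝ W = Module.finrank ℝ (W →L[ℝ] ℝ) := by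
    rw [← (LinearMap.toContinuousLinearMap (E := W) (F' := ℝ)).finrank_eq]
    exact (Subspace.dual_finrank_eq (K := ℝ) (V := W)).symm
  let e := LinearEquiv.ofInjectiveOfFinrankEq _ hinj hdim
  refine ⟨e.toContinuousLinearEquiv, ?_⟩
  ext v w
  rfl

end Flat

/-! ### The Poisson bracket of a symplectic form on an open set of a vector space -/

section Local

variable {W : Type*} [NormedAddCommGroup W] [NormedSpace ℝ W]

/-- The Hamiltonian vector field of a function on a vector space. -/
def localHam (Θ : W → W [⋀^Fin 2]→L[ℝ] ℝ) (F : W → ℝ) (p : W) : W :=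
  (flat (Θ p)).inverse (fderiv ℝ F p)

/-- The Poisson bracket of functions on a vector space. -/
def localBracket (Θ : W → W [⋀^Fin 2]→L[ℝ] ℝ) (F G : W → ℝ) (p : W) : ℝ :=
  fderiv ℝ F p (localHam Θ G p)

variable [FiniteDimensional ℝ W] {Θ : W → W [⋀^Fin 2]→L[ℝ] ℝ} {O : Set W}

theorem localHam_spec {p : W} (h : ∀ v, (∀ w, Θ p ![v, w] = 0) → v = 0) (F : W → ℝ) (w : W) :
    Θ p ![localHam Θ F p, w] = fderiv ℝ F p w := by
  obtain ⟨e, he⟩ := exists_equiv_eq_flat h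
  rw [← flat_apply, localHam, ← he, ContinuousLinearMap.inverse_equiv]
  simp

theorem contDiffOn_localHam (hO : IsOpen O) (hΘ : ContDiffOn ℝ ∞ Θ O)
    (hnd : ∀ p ∈ O, ∀ v, (∀ w, Θ p ![v, w] = 0) → v = 0) {F : W → ℝ}
    (hF : ContDiffOn ℝ ∞ F O) : ContDiffOn ℝ ∞ (localHam Θ F) O := by
  have h1 : ContDiffOn ℝ ∞ (fun p => flat (Θ p)) O := by
    refine contDiffOn_clm_apply.2 fun v => contDiffOn_clm_apply.2 fun w => ?_
    simp only [flat_apply]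
    exact (ContinuousAlternatingMap.apply ℝ W ℝ ![v, w]).contDiff.comp_contDiffOn hΘ
  refine ContDiffOn.clm_apply (f := fun p => (flat (Θ p)).inverse) ?_
    (hF.fderiv_of_isOpen hO (by simp))
  intro p hp
  obtain ⟨e, he⟩ := exists_equiv_eq_flat (hnd p hp)
  have h2 := contDiffAt_map_inverse (n := ∞) e
  rw [he] at h2
  exact ContDiffAt.comp_contDiffWithinAt (f := fun p => flat (Θ p)) p h2 (h1 p hp)

theorem contDiffOn_localBracket (hO : IsOpen O) (hΘ : ContDiffOn ℝ ∞ Θ O)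
    (hnd : ∀ p ∈ O, ∀ v, (∀ w, Θ p ![v, w] = 0) → v = 0) {F G : W → ℝ}
    (hF : ContDiffOn ℝ ∞ F O) (hG : ContDiffOn ℝ ∞ G O) :
    ContDiffOn ℝ ∞ (localBracket Θ F G) O :=
  (hF.fderiv_of_isOpen hO (by simp)).clm_apply (contDiffOn_localHam hO hΘ hnd hG)

omit [FiniteDimensional ℝ W] in
theorem extDeriv_two_apply {p : W} (hΘ : DifferentiableAt ℝ Θ p) (a b c : W) :
    extDeriv Θ p ![a, b, c] = fderiv ℝ Θ p a ![b, c] - fderiv ℝ Θ p b ![a, c] +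
      fderiv ℝ Θ p c ![a, b] := by
  rw [extDeriv_apply hΘ, Fin.sum_univ_three]
  have h : ∀ u : Fin 2 → W, fderiv ℝ (fun x => Θ x u) p = fun v => fderiv ℝ Θ p v u := by
    intro u
    ext v
    rw [fderiv_continuousAlternatingMap_apply_const_apply hΘ]
  have h0 : (0 : Fin 3).removeNth ![a, b, c] = ![b, c] := by
    ext i; fin_cases i <;> rfl
  have h1 : (1 : Fin 3).removeNth ![a, b, c] = ![a, c] := by
    ext i; fin_cases i <;> rfl
  have h2 : (2 : Fin 3).removeNth ![a, b, c] = ![a, b] := by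
    ext i; fin_cases i <;> rfl
  simp only [h0, h1, h2, h]
  simp
  ring

omit [FiniteDimensional ℝ W] in
theorem fderiv_two_form_apply {p : W} (hΘ : DifferentiableAt ℝ Θ p) {X : W → W}
    (hX : DifferentiableAt ℝ X p) (u w : W) :
    fderiv ℝ (fun q => Θ q ![X q, w]) p u = fderiv ℝ Θ p u ![X p, w] +
      Θ p ![fderiv ℝ X p u, w] := by
  have h1 : ∀ i, DifferentiableAt ℝ ((![X, fun _ => w] : Fin 2 → W → W) i) p := by
    intro i
    fin_cases i
    exacts [hX, differentiableAt_const w]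
  have h2 := fderiv_continuousAlternatingMap_apply_apply hΘ h1 u
  have h3 : ∀ q, (fun i => (![X, fun _ => w] : Fin 2 → W → W) i q) = ![X q, w] := by
    intro q
    ext i
    fin_cases i <;> rfl
  simp only [h3, Fin.sum_univ_two] at h2
  rw [h2]
  have h4 : Function.update ![X p, w] 0 (fderiv ℝ X p u) = ![fderiv ℝ X p u, w] := by
    ext i
    fin_cases i <;> rfl
  have h5 : Θ p (Function.update ![X p, w] 1 0) = 0 :=
    (Θ p).map_coord_zero 1 (by simp)
  simp [h4, h5]

/-- The derivative of a Poisson bracket. -/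
theorem fderiv_localBracket (hO : IsOpen O) (hΘ : ContDiffOn ℝ ∞ Θ O)
    (hnd : ∀ p ∈ O, ∀ v, (∀ w, Θ p ![v, w] = 0) → v = 0) {F G : W → ℝ}
    (hF : ContDiffOn ℝ ∞ F O) (hG : ContDiffOn ℝ ∞ G O) {p : W} (hp : p ∈ O) (u : W) :
    fderiv ℝ (localBracket Θ F G) p u = fderiv ℝ (fderiv ℝ F) p u (localHam Θ G p) -
      fderiv ℝ (fderiv ℝ G) p u (localHam Θ F p) +
      fderiv ℝ Θ p u ![localHam Θ G p, localHam Θ F p] := by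
  have hO' := hO.mem_nhds hp
  have dΘ : DifferentiableAt ℝ Θ p := (hΘ.contDiffAt hO').differentiableAt (by simp)
  have dX : DifferentiableAt ℝ (localHam Θ G) p :=
    ((contDiffOn_localHam hO hΘ hnd hG).contDiffAt hO').differentiableAt (by simp)
  have d2 : ∀ {F : W → ℝ}, ContDiffOn ℝ ∞ F O → DifferentiableAt ℝ (fderiv ℝ F) p := fun hF =>
    ((hF.fderiv_of_isOpen hO (m := ∞) (by simp)).contDiffAt hO').differentiableAt (by simp)
  have e1 : fderiv ℝ (localBracket Θ F G) p u = fderiv ℝ (fderiv ℝ F) p u (localHam Θ G p) +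
      fderiv ℝ F p (fderiv ℝ (localHam Θ G) p u) := by
    have := ((d2 hF).hasFDerivAt.clm_apply dX.hasFDerivAt).fderiv
    unfold localBracket
    rw [this]
    simp
    ring
  -- Differentiating `Θ(X_G, w) = dG(w)` with `w = X_F(p)` frozen expresses the derivative of `X_G`
  -- through second derivatives of `G` and first derivatives of `Θ`, without differentiating an
  -- inverse.
  have e2 : fderiv ℝ (fderiv ℝ G) p u (localHam Θ F p) =
      fderiv ℝ Θ p u ![localHam Θ G p, localHam Θ F p] +
        Θ p ![fderiv ℝ (localHam Θ G) p u, localHam Θ F p] := by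
    rw [← fderiv_two_form_apply dΘ dX]
    have := ((d2 hG).hasFDerivAt.clm_apply (hasFDerivAt_const (localHam Θ F p) p)).fderiv
    have h3 : fderiv ℝ (fderiv ℝ G) p u (localHam Θ F p) =
        fderiv ℝ (fun q => fderiv ℝ G q (localHam Θ F p)) p u := by
      rw [this]; simp
    rw [h3]
    congr 1
    apply Filter.EventuallyEq.fderiv_eq
    filter_upwards [hO'] with q hq
    rw [localHam_spec (hnd q hq)]
  rw [e1, e2, ← localHam_spec (hnd p hp) F, flat_skew (Θ p) (localHam Θ F p)]
  ring

/-- The Jacobi identity for the Poisson bracket of a symplectic form on an open subset of a vector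
space. -/
theorem localBracket_jacobi (hO : IsOpen O) (hΘ : ContDiffOn ℝ ∞ Θ O)
    (hnd : ∀ p ∈ O, ∀ v, (∀ w, Θ p ![v, w] = 0) → v = 0) {F G K : W → ℝ}
    (hF : ContDiffOn ℝ ∞ F O) (hG : ContDiffOn ℝ ∞ G O) (hK : ContDiffOn ℝ ∞ K O) {p : W}
    (hp : p ∈ O) (hcl : extDeriv Θ p = 0) :
    localBracket Θ F (localBracket Θ G K) p + localBracket Θ G (localBracket Θ K F) p +
      localBracket Θ K (localBracket Θ F G) p = 0 := by
  have hO' := hO.mem_nhds hp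
  have dΘ : DifferentiableAt ℝ Θ p := (hΘ.contDiffAt hO').differentiableAt (by simp)
  have swap : ∀ A B : W → ℝ, localBracket Θ A B p = -fderiv ℝ B p (localHam Θ A p) := by
    intro A B
    rw [localBracket, ← localHam_spec (hnd p hp), ← localHam_spec (hnd p hp), flat_skew]
  have sym : ∀ {F : W → ℝ}, ContDiffOn ℝ ∞ F O → ∀ u v : W,
      fderiv ℝ (fderiv ℝ F) p u v = fderiv ℝ (fderiv ℝ F) p v u := by
    intro F hF u v
    exact ((hF.contDiffAt hO').isSymmSndFDerivAt (by
      rw [minSmoothness_of_isRCLikeNormedField]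
      exact WithTop.coe_le_coe.2 le_top)).eq u v
  have h := extDeriv_two_apply dΘ (localHam Θ F p) (localHam Θ G p) (localHam Θ K p)
  rw [hcl] at h
  simp only [ContinuousAlternatingMap.coe_zero, Pi.zero_apply] at h
  -- The second derivatives cancel in pairs by symmetry; the three remaining terms are, up to
  -- skew-symmetry, those of `dΘ(X_F, X_G, X_K)`.
  rw [swap F, swap G, swap K, fderiv_localBracket hO hΘ hnd hG hK hp,
    fderiv_localBracket hO hΘ hnd hK hF hp, fderiv_localBracket hO hΘ hnd hF hG hp,
    sym hF (localHam Θ K p), sym hG (localHam Θ F p), sym hK (localHam Θ G p),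
    flat_skew _ (localHam Θ K p), flat_skew _ (localHam Θ F p) (localHam Θ K p),
    flat_skew _ (localHam Θ G p) (localHam Θ F p)]
  have h' := flat_skew (fderiv ℝ Θ p (localHam Θ G p)) (localHam Θ K p) (localHam Θ F p)
  linarith

end Local

/-! ### Symplectic bases -/

section SymplecticBasis

/-- A finite-dimensional vector space with a nondegenerate alternating bilinear form has a
symplectic basis `(e i 0, e i 1)`. -/
theorem exists_symplectic_basis (d : ℕ) : ∀ {K : Type*} [AddCommGroup K] [Module ℝ K]
    [FiniteDimensional ℝ K] (B : K →ₗ[ℝ] K →ₗ[ℝ] ℝ), (∀ v, B v v = 0) →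
    (∀ v, (∀ w, B v w = 0) → v = 0) → Module.finrank ℝ K = d →
    ∃ n : ℕ, d = 2 * n ∧ ∃ e : Fin n → Fin 2 → K, ∀ i j a b,
      B (e i a) (e j b) = if i = j then ((b : ℕ) : ℝ) - ((a : ℕ) : ℝ) else 0 := by
  induction d using Nat.strong_induction_on with
  | _ d ih =>
  intro K _ _ _ B halt hnd hd
  rcases Nat.eq_zero_or_pos d with rfl | hpos
  · exact ⟨0, rfl, fun i => i.elim0, fun i => i.elim0⟩
  have hskew : ∀ x y, B x y = -B y x := by
    intro x y
    have := halt (x + y)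
    simp only [map_add, LinearMap.add_apply, halt] at this
    linarith
  have : Nontrivial K := Module.nontrivial_of_finrank_pos (R := ℝ) (hd ▸ hpos)
  obtain ⟨v, hv⟩ := exists_ne (0 : K)
  -- Induction on the dimension: split off the hyperbolic plane of `v` and `w` and continue in its
  -- orthogonal complement, the kernel of `Φ`.
  obtain ⟨w, hvw⟩ : ∃ w, B v w = 1 := by
    by_contra! h
    refine hv (hnd v fun w => ?_)
    by_contra hw
    exact h ((B v w)⁻¹ • w) (by simp [hw])
  have hwv : B w v = -1 := by rw [hskew, hvw]
  let Φ : K →ₗ[ℝ] ℝ × ℝ := (B v).prod (B w)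
  have hΦ : LinearMap.range Φ = ⊤ := by
    rw [LinearMap.range_eq_top]
    rintro ⟨a, b⟩
    refine ⟨a • w - b • v, ?_⟩
    simp [Φ, halt, hvw, hwv]
  have hdim := Φ.finrank_range_add_finrank_ker
  rw [hΦ, finrank_top, Module.finrank_prod, Module.finrank_self, hd] at hdim
  let B' : LinearMap.ker Φ →ₗ[ℝ] LinearMap.ker Φ →ₗ[ℝ] ℝ :=
    B.compl₁₂ (LinearMap.ker Φ).subtype (LinearMap.ker Φ).subtype
  have hker : ∀ x : LinearMap.ker Φ, B v x = 0 ∧ B w x = 0 := by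
    intro x
    have := x.2
    rw [LinearMap.mem_ker] at this
    exact ⟨congrArg Prod.fst this, congrArg Prod.snd this⟩
  have hker' : ∀ x : LinearMap.ker Φ, B x v = 0 ∧ B x w = 0 := by
    intro x
    rw [hskew, hskew x.1 w, (hker x).1, (hker x).2]
    simp
  obtain ⟨n, hn, e, he⟩ := ih (Module.finrank ℝ (LinearMap.ker Φ)) (by omega) B'
    (fun x => halt x) (fun x hx => by
      refine Subtype.ext (hnd x fun z => ?_)
      -- The projection of `z` to the complement; the discarded part pairs to zero with `x`, so
      -- nondegeneracy is inherited.
      have hz : z + B w z • v - B v z • w ∈ LinearMap.ker Φ := by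
        rw [LinearMap.mem_ker]
        simp [Φ, halt, hvw, hwv]
      have := hx ⟨_, hz⟩
      simpa [B', hker' x] using this) rfl
  refine ⟨n + 1, by omega, Fin.cons ![v, w] (fun i a => (e i a : K)), ?_⟩
  intro i j a b
  refine Fin.cases ?_ (fun i => ?_) i <;> refine Fin.cases ?_ (fun j => ?_) j
  · fin_cases a <;> fin_cases b <;> simp [halt, hvw, hwv]
  · fin_cases a <;> simp [hker, (Fin.succ_ne_zero j).symm]
  · fin_cases b <;> simp [hker', Fin.succ_ne_zero i]
  · simpa [B'] using he i j a b

end SymplecticBasis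

/-! ### Nonvanishing of `η ∧ α^n` on an adapted basis -/

section Volume

open Equiv

/-- A permutation of `Fin n × Fin 2` mapping blocks `{i} × Fin 2` to blocks has as its sign the
product of the signs of the induced orderings of the blocks. -/
theorem sign_eq_prod_of_blocks {n : ℕ} (π : Perm (Fin n × Fin 2))
    (h : ∀ i, (π (i, 0)).1 = (π (i, 1)).1) :
    ((Perm.sign π : ℤ) : ℝ) =
      ∏ i, ((((π (i, 1)).2 : ℕ) : ℝ) - (((π (i, 0)).2 : ℕ) : ℝ)) := by
  let p : Fin n → Fin n := fun i => (π (i, 0)).1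
  have hp : ∀ x, (π x).1 = p x.1 := by
    rintro ⟨i, a⟩
    fin_cases a
    exacts [rfl, (h i).symm]
  have hsurj : Function.Surjective p := fun k =>
    ⟨(π.symm (k, 0)).1, by rw [← hp, Equiv.apply_symm_apply]⟩
  have hinj : Function.Injective p := Finite.injective_iff_surjective.2 hsurj
  let P : Perm (Fin n) := Equiv.ofBijective p ⟨hinj, hsurj⟩
  have hτ : ∀ i, Function.Injective fun a => (π (i, a)).2 := by
    intro i a b hab
    have : π (i, a) = π (i, b) := Prod.ext (by rw [hp, hp]) hab
    simpa using π.injective this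
  let τ : Fin n → Perm (Fin 2) := fun i =>
    Equiv.ofBijective _ ⟨hτ i, Finite.injective_iff_surjective.1 (hτ i)⟩
  -- The block permutation `P` acts once on each of the two columns, so its sign enters squared and
  -- only the `τ i` count.
  have hπ : π = prodCongrLeft (fun _ : Fin 2 => P) * prodCongrRight τ := by
    ext ⟨i, a⟩
    · simp only [hp]
      rfl
    · rfl
  -- The same expression `b - a` as the values of the form on a symplectic basis; this is what
  -- matches signs with products of values below.
  have key : ∀ ρ : Perm (Fin 2), (Perm.sign ρ : ℤ) = ((ρ 1 : ℕ) : ℤ) - ((ρ 0 : ℕ) : ℤ) := by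
    decide
  have h1 : Perm.sign π = ∏ i, Perm.sign (τ i) := by
    rw [hπ, Perm.sign_mul, Perm.sign_prodCongrLeft, Perm.sign_prodCongrRight]
    simp
  rw [h1]
  push_cast
  refine Finset.prod_congr rfl fun i _ => ?_
  rw [key (τ i)]
  push_cast
  rfl

/-- The index set of `η ∧ α^n`. -/
def blockEquiv (n : ℕ) : Option (Fin n × Fin 2) ≃ Fin (2 * n + 1) :=
  (Equiv.optionCongr (finProdFinEquiv.trans (finCongr (Nat.mul_comm n 2)))).trans
    (finSuccEquiv (2 * n)).symm

theorem blockEquiv_none (n : ℕ) : blockEquiv n none = 0 := by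
  simp [blockEquiv]

theorem blockEquiv_some_zero {n : ℕ} (i : Fin n) :
    blockEquiv n (some (i, 0)) = ⟨2 * i + 1, by omega⟩ := by
  apply Fin.ext
  simp [blockEquiv]

theorem blockEquiv_some_one {n : ℕ} (i : Fin n) :
    blockEquiv n (some (i, 1)) = ⟨2 * i + 2, by omega⟩ := by
  apply Fin.ext
  simp [blockEquiv]
  omega

/-- No cancellation occurs: a permutation with nonzero contribution fixes the `η` slot and maps
blocks to blocks, so its product of values equals its sign and its term is a square. The identity
contributes `1`. -/
theorem wedge_sum_pos {n : ℕ} {K : Type*} (B : K → K → ℝ) (η : K → ℝ)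
    (R : K) (e : Fin n → Fin 2 → K) (hR : η R = 1) (hη : ∀ i a, η (e i a) = 0)
    (he : ∀ i j a b, B (e i a) (e j b) = if i = j then ((b : ℕ) : ℝ) - ((a : ℕ) : ℝ) else 0)
    (v : Fin (2 * n + 1) → K)
    (hv : v = fun k => ((blockEquiv n).symm k).elim R fun x => e x.1 x.2) :
    0 < ∑ σ : Perm (Fin (2 * n + 1)), ((Perm.sign σ : ℤ) : ℝ) *
      (η (v (σ 0)) * ∏ i : Fin n, B (v (σ ⟨2 * i + 1, by omega⟩)) (v (σ ⟨2 * i + 2, by omega⟩))) := by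
  let u : Option (Fin n × Fin 2) → K := fun o => o.elim R fun x => e x.1 x.2
  have hvu : ∀ x, v (blockEquiv n x) = u x := by
    intro x
    simp [hv, u]
  -- Conjugation by `blockEquiv` preserves signs and turns position `0` into `none` and positions
  -- `2i + 1`, `2i + 2` into block `i`.
  rw [← Equiv.sum_comp (blockEquiv n).permCongr]
  have hterm : ∀ (τ : Perm (Option (Fin n × Fin 2))),
      ((Perm.sign ((blockEquiv n).permCongr τ) : ℤ) : ℝ) *
      (η (v ((blockEquiv n).permCongr τ 0)) * ∏ i : Fin n,
        B (v ((blockEquiv n).permCongr τ ⟨2 * i + 1, by omega⟩))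
          (v ((blockEquiv n).permCongr τ ⟨2 * i + 2, by omega⟩))) =
      ((Perm.sign τ : ℤ) : ℝ) * (η (u (τ none)) * ∏ i : Fin n,
        B (u (τ (some (i, 0)))) (u (τ (some (i, 1))))) := by
    intro τ
    simp only [Perm.sign_permCongr, ← blockEquiv_none, ← blockEquiv_some_zero,
      ← blockEquiv_some_one, Equiv.permCongr_apply, Equiv.symm_apply_apply, hvu]
  simp only [hterm]
  refine Finset.sum_pos' (fun τ _ => ?_) ⟨1, Finset.mem_univ _, ?_⟩
  · by_cases h0 : η (u (τ none)) = 0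
    · simp [h0]
    by_cases h1 : ∏ i : Fin n, B (u (τ (some (i, 0)))) (u (τ (some (i, 1)))) = 0
    · simp [h1]
    have hn : τ none = none := by
      rcases h : τ none with _ | x
      · rfl
      · rw [h] at h0
        exact absurd (hη x.1 x.2) h0
    obtain ⟨π, rfl⟩ : ∃ π : Perm (Fin n × Fin 2), τ = optionCongr π := by
      refine ⟨Equiv.removeNone τ, ?_⟩
      refine ((Perm.decomposeOption).symm_apply_apply τ).symm.trans ?_
      simp only [Perm.decomposeOption_symm_apply, Perm.decomposeOption_apply, hn, swap_self,
        ← Perm.one_def, one_mul]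
    have hu : ∀ x, u (optionCongr π (some x)) = e (π x).1 (π x).2 := fun x => rfl
    simp only [hu, he] at h1 ⊢
    have hblock : ∀ i, (π (i, 0)).1 = (π (i, 1)).1 := by
      intro i
      by_contra hi
      exact h1 (Finset.prod_eq_zero (Finset.mem_univ i) (if_neg hi))
    simp only [hblock, if_true]
    rw [← sign_eq_prod_of_blocks π hblock, optionCongr_sign]
    have : η (u (optionCongr π none)) = 1 := hR
    rw [this, one_mul]
    exact mul_self_nonneg _
  · simp [u, hR, he]

end Volume

/-! ### Pointwise solution of the Hamiltonian equations -/

section OneForm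

variable {E : Type*} [NormedAddCommGroup E] [NormedSpace ℝ E]

/-- An alternating `1`-form as a linear functional. -/
def functional (β : E [⋀^Fin 1]→L[ℝ] ℝ) : E →L[ℝ] ℝ :=
  (ContinuousAlternatingMap.ofSubsingletonLIE (𝕜 := ℝ) (E := E) (F := ℝ) (0 : Fin 1)).symm β

@[simp]
theorem functional_apply (β : E [⋀^Fin 1]→L[ℝ] ℝ) (w : E) : functional β w = β ![w] := by
  change β (fun _ => w) = _
  congr 1
  ext i
  fin_cases i
  rfl

end OneForm

section Symplectic

variable {E : Type*} [NormedAddCommGroup E] [NormedSpace ℝ E] [FiniteDimensional ℝ E]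
  {M : Type*} [TopologicalSpace M] [ChartedSpace E M] {Ω : DiffForm E M 2} {x : M}

/-- The defining equation is solvable by nondegeneracy, so the choice operator returns a genuine
solution. -/
theorem hamiltonianField_spec (h : ∀ v, (∀ w, Ω x ![v, w] = 0) → v = 0) (f : M → ℝ) (w : E) :
    Ω x ![hamiltonianField Ω f x, w] = dFun f x w := by
  obtain ⟨e, he⟩ := exists_equiv_eq_flat h
  have hex : ∃ X : E, ∀ w, Ω x ![X, w] = dFun f x w := by
    refine ⟨e.symm (tangentMapAt f x), fun w => ?_⟩
    rw [← flat_apply, ← he]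
    simp [dFun]
  exact Classical.epsilon_spec hex w

theorem hamiltonianField_eq (h : ∀ v, (∀ w, Ω x ![v, w] = 0) → v = 0) {f : M → ℝ} {X : E}
    (hX : ∀ w, Ω x ![X, w] = dFun f x w) : hamiltonianField Ω f x = X := by
  rw [← sub_eq_zero]
  refine h _ fun w => ?_
  rw [← flat_apply, map_sub, sub_apply, flat_apply, flat_apply, hX,
    hamiltonianField_spec h, sub_self]

theorem symplecticBracket_skew (h : ∀ v, (∀ w, Ω x ![v, w] = 0) → v = 0) (f g : M → ℝ) :
    symplecticBracket Ω f g x = -symplecticBracket Ω g f x := by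
  rw [symplecticBracket, symplecticBracket, ← hamiltonianField_spec h, ← hamiltonianField_spec h,
    flat_skew]

end Symplectic

/-! ### Nondegenerate pairs: Reeb vector, volume, Hamiltonian vector -/

section Cosymplectic

variable {E : Type*} [NormedAddCommGroup E] [NormedSpace ℝ E]

/-- The pair `(α, η)` of a `2`-form and a `1`-form is nondegenerate: the `2`-form
`α + η ∧ ds` on `E × ℝ` is. -/
def PairNondegenerate (α : E [⋀^Fin 2]→L[ℝ] ℝ) (η : E [⋀^Fin 1]→L[ℝ] ℝ) : Prop :=
  ∀ (u : E) (a : ℝ), (∀ w, α ![u, w] = a * η ![w]) → η ![u] = 0 → u = 0 ∧ a = 0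

variable [FiniteDimensional ℝ E] {α : E [⋀^Fin 2]→L[ℝ] ℝ} {η : E [⋀^Fin 1]→L[ℝ] ℝ}

/-- The linear map `(u, a) ↦ (α(u, ·) - a η, η(u))` is injective by hypothesis, and source and
target have equal dimension. The choices `(0, 1)` and `(dg, 0)` of `(l, c)` give the Reeb and
Hamiltonian vectors. -/
theorem PairNondegenerate.exists_solution (h : PairNondegenerate α η) (l : E →L[ℝ] ℝ) (c : ℝ) :
    ∃ (u : E) (a : ℝ), (∀ w, α ![u, w] - a * η ![w] = l w) ∧ η ![u] = c := by
  let T : E × ℝ →ₗ[ℝ] (E →L[ℝ] ℝ) × ℝ :=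
    LinearMap.prod
      ((flat α : E →ₗ[ℝ] E →L[ℝ] ℝ) ∘ₗ LinearMap.fst ℝ E ℝ -
        (LinearMap.toSpanSingleton ℝ (E →L[ℝ] ℝ) (functional η)) ∘ₗ LinearMap.snd ℝ E ℝ)
      ((functional η : E →ₗ[ℝ] ℝ) ∘ₗ LinearMap.fst ℝ E ℝ)
  have hT1 : ∀ u a w, (T (u, a)).1 w = α ![u, w] - a * η ![w] := by
    intro u a w
    simp [T]
  have hT2 : ∀ u a, (T (u, a)).2 = η ![u] := by
    intro u a
    simp [T]
  have hinj : Function.Injective T := by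
    rw [injective_iff_map_eq_zero]
    rintro ⟨u, a⟩ hu
    have := h u a (fun w => by
      have := hT1 u a w
      rw [hu] at this
      simp at this
      linarith) (by rw [← hT2 u a, hu]; rfl)
    simp [this]
  have hdim : Module.finrank ℝ (E × ℝ) = Module.finrank ℝ ((E →L[ℝ] ℝ) × ℝ) := by
    rw [Module.finrank_prod, Module.finrank_prod,
      ← (LinearMap.toContinuousLinearMap (E := E) (F' := ℝ)).finrank_eq]
    congr 1
    exact (Subspace.dual_finrank_eq (K := ℝ) (V := E)).symm
  obtain ⟨⟨u, a⟩, hu⟩ := (LinearMap.injective_iff_surjective_of_finrank_eq_finrank hdim).1 hinj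
    (l, c)
  exact ⟨u, a, fun w => by rw [← hT1, hu], by rw [← hT2 u a, hu]⟩

theorem PairNondegenerate.exists_reeb (h : PairNondegenerate α η) :
    ∃ R, (∀ w, α ![R, w] = 0) ∧ η ![R] = 1 := by
  obtain ⟨R, a, hR, hη⟩ := h.exists_solution 0 1
  -- Testing the equation on `R` itself leaves `-a η(R) = -a`.
  have ha : a = 0 := by
    have := hR R
    simpa [flat_self, hη] using this
  exact ⟨R, fun w => by simpa [ha] using hR w, hη⟩

theorem PairNondegenerate.exists_volume {M : Type*} (α : M → E [⋀^Fin 2]→L[ℝ] ℝ)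
    (η : M → E [⋀^Fin 1]→L[ℝ] ℝ) [TopologicalSpace M] [ChartedSpace E M] (x : M)
    (h : PairNondegenerate (α x) (η x)) :
    ∃ n : ℕ, Module.finrank ℝ E = 2 * n + 1 ∧ ∃ v, etaWedgeOmegaPow α η n x v ≠ 0 := by
  obtain ⟨R, hR, hηR⟩ := h.exists_reeb
  let l : E →ₗ[ℝ] ℝ := functional (η x)
  have hl : ∀ w, l w = η x ![w] := functional_apply _
  have hrange : LinearMap.range l = ⊤ := by
    rw [LinearMap.range_eq_top]
    exact fun c => ⟨c • R, by rw [map_smul, hl, hηR]; simp⟩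
  have hdim := l.finrank_range_add_finrank_ker
  rw [hrange, finrank_top, Module.finrank_self] at hdim
  let α' : E →ₗ[ℝ] E →ₗ[ℝ] ℝ := (ContinuousLinearMap.coeLM ℝ) ∘ₗ (flat (α x) : E →ₗ[ℝ] E →L[ℝ] ℝ)
  have hα' : ∀ v w, α' v w = α x ![v, w] := flat_apply _
  let B : LinearMap.ker l →ₗ[ℝ] LinearMap.ker l →ₗ[ℝ] ℝ :=
    α'.compl₁₂ (LinearMap.ker l).subtype (LinearMap.ker l).subtype
  have hB : ∀ v w : LinearMap.ker l, B v w = α x ![v, w] := fun v w => hα' v w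
  obtain ⟨n, hn, e, he⟩ := exists_symplectic_basis _ B (fun v => by rw [hB, flat_self])
    (fun u hu => by
      refine Subtype.ext (h u 0 (fun w => ?_) ?_).1
      -- Every `w` differs from an element of `ker η` by a multiple of `R`, which `α` annihilates;
      -- so a vector degenerate on `ker η` is degenerate on all of `E`.
      · have hw : w - (η x ![w]) • R ∈ LinearMap.ker l := by
          rw [LinearMap.mem_ker, map_sub, map_smul, hl, hl, hηR]
          simp
        have := hu ⟨_, hw⟩
        rw [hB, ← flat_apply, map_sub, map_smul, flat_apply, flat_apply, flat_skew _ _ R, hR] at this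
        simpa using this
      · rw [← hl]
        exact u.2) rfl
  refine ⟨n, by omega, fun k => ((blockEquiv n).symm k).elim R fun y => e y.1 y.2, ?_⟩
  have hpos := wedge_sum_pos (n := n) (fun v w => α x ![v, w]) (fun v => η x ![v]) R
    (fun i a => (e i a : E)) hηR (fun i a => by rw [← hl]; exact (e i a).2)
    (fun i j a b => by rw [← hB]; exact he i j a b) _ rfl
  exact (mul_pos (by positivity) hpos).ne'

end Cosymplectic

section CosymplecticField

variable {E : Type*} [NormedAddCommGroup E] [NormedSpace ℝ E] [FiniteDimensional ℝ E]
  {M : Type*} [TopologicalSpace M] [ChartedSpace E M] {α : DiffForm E M 2} {η : DiffForm E M 1}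
  {x : M}

omit [TopologicalSpace M] [ChartedSpace E M] in
theorem reebField_spec (h : PairNondegenerate (α x) (η x)) :
    (∀ w, α x ![reebField α η x, w] = 0) ∧ η x ![reebField α η x] = 1 :=
  Classical.epsilon_spec h.exists_reeb

theorem cosymplecticHamiltonianField_eq (h : PairNondegenerate (α x) (η x)) {f : M → ℝ} {u : E}
    {a : ℝ} (hu : ∀ w, α x ![u, w] - a * η x ![w] = dFun f x w) (hη : η x ![u] = 0) :
    cosymplecticHamiltonianField α η f x = u := by
  obtain ⟨hR, hηR⟩ := reebField_spec h
  -- Evaluation on the Reeb vector identifies the auxiliary scalar as `-R(f)`, turning the equation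
  -- for `(u, a)` into the defining one.
  have ha : dFun f x (reebField α η x) = -a := by
    rw [← hu, flat_skew, hR, hηR]
    ring
  have hspec : (∀ w, α x ![u, w] = dFun f x w - dFun f x (reebField α η x) * η x ![w]) ∧
      η x ![u] = 0 := ⟨fun w => by rw [ha, ← hu]; ring, hη⟩
  obtain ⟨h1, h2⟩ := Classical.epsilon_spec (p := fun X : E =>
    (∀ w, α x ![X, w] = dFun f x w - dFun f x (reebField α η x) * η x ![w]) ∧ η x ![X] = 0)
    ⟨u, hspec⟩
  rw [← sub_eq_zero]
  refine (h _ 0 (fun w => ?_) ?_).1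
  · rw [← flat_apply, map_sub, sub_apply, flat_apply, flat_apply, hspec.1,
      cosymplecticHamiltonianField, h1]
    ring
  · rw [← functional_apply, map_sub, functional_apply, functional_apply, hspec.2,
      cosymplecticHamiltonianField, h2, sub_zero]

end CosymplecticField

/-! ### Parametrization of the total space by a local section and the flow -/

section LocalModel

variable {E : Type*} [NormedAddCommGroup E] [NormedSpace ℝ E]
  {A : Type*} [TopologicalSpace A] [ChartedSpace E A]
  {E' : Type*} [NormedAddCommGroup E'] [NormedSpace ℝ E']
  {V : Type*} [TopologicalSpace V] [ChartedSpace E' V]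

variable (E E') in
/-- A local section of `μ`, read in the preferred chart at `x₀`. -/
structure IsLocalSection (μ : A → V) (x₀ : V) (O : Set E') (σ : E' → A) : Prop where
  isOpen : IsOpen O
  subset : O ⊆ (extChartAt 𝓘(ℝ, E') x₀).target
  smooth : ContMDiffOn 𝓘(ℝ, E') 𝓘(ℝ, E) ∞ σ O
  proj : ∀ y ∈ O, μ (σ y) = (extChartAt 𝓘(ℝ, E') x₀).symm y

/-- The parametrization `(y, s) ↦ ψ_s(σ(y))` of `A` given by a local section `σ`. -/
def flowOut (ψ : ℝ → A → A) (σ : E' → A) : E' × ℝ → A := fun p => ψ p.2 (σ p.1)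

/-- The symplectic form in the parametrization given by a local section. -/
def modelForm (Ω : DiffForm E A 2) (ψ : ℝ → A → A) (σ : E' → A) :
    E' × ℝ → (E' × ℝ) [⋀^Fin 2]→L[ℝ] ℝ :=
  DiffForm.pullback (E := E' × ℝ) (flowOut ψ σ) Ω

/-- A function on the base in the parametrization given by a local section. -/
def baseRep (x₀ : V) (f : V → ℝ) : E' × ℝ → ℝ :=
  fun p => f ((extChartAt 𝓘(ℝ, E') x₀).symm p.1)

variable {Ω : DiffForm E A 2} {ψ : ℝ → A → A} {μ : A → V} {x₀ : V} {O : Set E'} {σ : E' → A}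

theorem modelForm_apply (p v w : E' × ℝ) :
    modelForm Ω ψ σ p ![v, w] = Ω (flowOut ψ σ p)
      ![tangentMapAt (E := E' × ℝ) (E' := E) (flowOut ψ σ) p v,
        tangentMapAt (E := E' × ℝ) (E' := E) (flowOut ψ σ) p w] := by
  unfold modelForm DiffForm.pullback
  rw [ContinuousAlternatingMap.compContinuousLinearMap_apply]
  congr 1
  ext i
  fin_cases i <;> rfl

theorem IsLocalSection.isOpen_prod (hσ : IsLocalSection E E' μ x₀ O σ) :
    IsOpen (O ×ˢ (Set.univ : Set ℝ)) :=
  hσ.isOpen.prod isOpen_univ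

theorem IsPrincipalRBundle.exists_isLocalSection [IsManifold 𝓘(ℝ, E') ∞ V]
    (hp : IsPrincipalRBundle E E' ψ μ)
    (x₀ : V) : ∃ (O : Set E') (σ : E' → A), IsLocalSection E E' μ x₀ O σ ∧
      extChartAt 𝓘(ℝ, E') x₀ x₀ ∈ O := by
  obtain ⟨e, he, -, hes, -⟩ := hp.locally_trivial x₀
  set φ := extChartAt 𝓘(ℝ, E') x₀ with hφ
  have hO : IsOpen (φ.target ∩ φ.symm ⁻¹' e.baseSet) :=
    (continuousOn_extChartAt_symm x₀).isOpen_inter_preimage (isOpen_extChartAt_target x₀)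
      e.open_baseSet
  -- The zero slice of a local trivialization.
  refine ⟨_, fun y => e.toOpenPartialHomeomorph.symm (φ.symm y, 0),
    ⟨hO, Set.inter_subset_left, ?_, ?_⟩, ⟨mem_extChartAt_target x₀, ?_⟩⟩
  · refine ContMDiffOn.comp (f := fun y => (φ.symm y, (0 : ℝ))) (t := e.target) hes
      (ContMDiffOn.prodMk ?_ contMDiffOn_const) ?_
    · exact (contMDiffOn_extChartAt_symm x₀).mono Set.inter_subset_left
    · intro y hy
      exact e.mem_target.2 hy.2
  · intro y hy
    exact e.proj_symm_apply' hy.2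
  · simpa [hφ] using he

theorem IsPrincipalRBundle.contMDiff_action (hp : IsPrincipalRBundle E E' ψ μ) (s : ℝ) :
    ContMDiff 𝓘(ℝ, E) 𝓘(ℝ, E) ∞ (ψ s) :=
  hp.smooth_action.comp (contMDiff_const.prodMk contMDiff_id)

theorem IsPrincipalRBundle.contMDiffOn_flowOut (hp : IsPrincipalRBundle E E' ψ μ)
    (hσ : IsLocalSection E E' μ x₀ O σ) :
    ContMDiffOn 𝓘(ℝ, E' × ℝ) 𝓘(ℝ, E) ∞ (flowOut ψ σ) (O ×ˢ (Set.univ : Set ℝ)) := by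
  refine hp.smooth_action.comp_contMDiffOn (f := fun p : E' × ℝ => (p.2, σ p.1))
    (ContMDiffOn.prodMk ?_ ?_)
  · exact contDiff_snd.contMDiff.contMDiffOn
  · exact hσ.smooth.comp contDiff_fst.contMDiff.contMDiffOn (fun p hp => hp.1)

theorem IsPrincipalRBundle.mdifferentiableAt_flowOut (hp : IsPrincipalRBundle E E' ψ μ)
    (hσ : IsLocalSection E E' μ x₀ O σ) {p : E' × ℝ} (hpO : p.1 ∈ O) :
    MDifferentiableAt 𝓘(ℝ, E' × ℝ) 𝓘(ℝ, E) (flowOut ψ σ) p :=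
  ((hp.contMDiffOn_flowOut hσ).contMDiffAt
    (hσ.isOpen_prod.mem_nhds ⟨hpO, trivial⟩)).mdifferentiableAt (by simp)

theorem IsPrincipalRBundle.proj_flowOut (hp : IsPrincipalRBundle E E' ψ μ)
    (hσ : IsLocalSection E E' μ x₀ O σ) {p : E' × ℝ} (hpO : p.1 ∈ O) :
    μ (flowOut ψ σ p) = (extChartAt 𝓘(ℝ, E') x₀).symm p.1 := by
  rw [flowOut, hp.proj_action, hσ.proj _ hpO]

omit [ChartedSpace E A] [ChartedSpace E' V] in
theorem eq_of_snd_eq (e : Bundle.Trivialization ℝ μ) {a b : A} (hb : μ b ∈ e.baseSet)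
    (h : μ a = μ b) (h2 : (e a).2 = (e b).2) : a = b := by
  have ha : μ a ∈ e.baseSet := h ▸ hb
  refine e.injOn (e.mem_source.2 ha) (e.mem_source.2 hb) (?_ : e a = e b)
  exact Prod.ext (by rw [e.coe_fst' ha, e.coe_fst' hb, h]) h2

/-- The fibres are orbits of the principal action. -/
theorem IsPrincipalRBundle.exists_action_eq (hp : IsPrincipalRBundle E E' ψ μ)
    {a b : A} (h : μ a = μ b) : ∃ s, ψ s a = b := by
  obtain ⟨e, he, -, -, heq⟩ := hp.locally_trivial (μ a)
  have ha : a ∈ e.source := e.mem_source.2 he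
  have hb : b ∈ e.source := e.mem_source.2 (h ▸ he)
  refine ⟨(e b).2 - (e a).2, eq_of_snd_eq e (e.mem_source.1 hb) ?_ ?_⟩
  · rw [hp.proj_action, h]
  · rw [heq a ha]
    ring

/-- An explicit smooth local inverse exists: the base coordinate of `b` is `φ(μ b)`, and its time is
the difference of the fibre coordinates of `b` and of the section point below it. The chain rule in
both orders then gives inverse tangent maps. -/
theorem IsPrincipalRBundle.bijective_tangentMapAt_flowOut [IsManifold 𝓘(ℝ, E') ∞ V]
    (hp : IsPrincipalRBundle E E' ψ μ)
    (hσ : IsLocalSection E E' μ x₀ O σ) {p : E' × ℝ} (hpO : p.1 ∈ O) :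
    Function.Bijective (tangentMapAt (E := E' × ℝ) (E' := E) (flowOut ψ σ) p) := by
  set φ := extChartAt 𝓘(ℝ, E') x₀ with hφ
  have hyφ : p.1 ∈ φ.target := hσ.subset hpO
  obtain ⟨e, he, hesm, -, heq⟩ := hp.locally_trivial (φ.symm p.1)
  set a := flowOut ψ σ p with ha
  have hμa : μ a = φ.symm p.1 := hp.proj_flowOut hσ hpO
  have hφμ : φ (μ a) = p.1 := by rw [hμa, φ.right_inv hyφ]
  let K : A → E' × ℝ := fun b => (φ (μ b), (e b).2 - (e (σ (φ (μ b)))).2)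
  have heAt : ∀ b, μ b = φ.symm p.1 →
      ContMDiffAt 𝓘(ℝ, E) (𝓘(ℝ, E').prod 𝓘(ℝ, ℝ)) ∞ e b := fun b hb =>
    hesm.contMDiffAt (e.open_source.mem_nhds (e.mem_source.2 (hb ▸ he)))
  have hφμsm : ContMDiffAt 𝓘(ℝ, E) 𝓘(ℝ, E') ∞ (fun b => φ (μ b)) a := by
    refine ContMDiffAt.comp a (g := φ) ?_ (hp.smooth_proj a)
    refine contMDiffAt_extChartAt' ?_
    rw [hμa, ← extChartAt_source 𝓘(ℝ, E')]
    exact φ.map_target hyφ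
  have hσsm : ContMDiffAt 𝓘(ℝ, E) 𝓘(ℝ, E) ∞ (fun b => σ (φ (μ b))) a :=
    ContMDiffAt.comp_of_eq (hσ.smooth.contMDiffAt (hσ.isOpen.mem_nhds hpO)) hφμsm hφμ
  have hK : ContMDiffAt 𝓘(ℝ, E) 𝓘(ℝ, E' × ℝ) ∞ K a := by
    refine ContMDiffAt.prodMk_space hφμsm (ContMDiffAt.sub ?_ ?_)
    · exact contMDiffAt_snd.comp a (heAt a hμa)
    · refine contMDiffAt_snd.comp a (ContMDiffAt.comp_of_eq (heAt (σ p.1) ?_) hσsm ?_)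
      · exact hσ.proj _ hpO
      · rw [hφμ]
  have hG := hp.mdifferentiableAt_flowOut hσ hpO
  have hKd := hK.mdifferentiableAt (by simp)
  have hKG : K ∘ flowOut ψ σ =ᶠ[nhds p] id := by
    have hU : IsOpen ((O ∩ φ.symm ⁻¹' e.baseSet) ×ˢ (Set.univ : Set ℝ)) := by
      refine IsOpen.prod ?_ isOpen_univ
      exact ((continuousOn_extChartAt_symm x₀).mono hσ.subset).isOpen_inter_preimage hσ.isOpen
        e.open_baseSet
    filter_upwards [hU.mem_nhds ⟨⟨hpO, he⟩, trivial⟩] with q hq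
    have h1 : φ (μ (flowOut ψ σ q)) = q.1 := by
      rw [hp.proj_flowOut hσ hq.1.1, φ.right_inv (hσ.subset hq.1.1)]
    refine Prod.ext h1 ?_
    change (e (flowOut ψ σ q)).2 - (e (σ (φ (μ (flowOut ψ σ q))))).2 = q.2
    rw [h1, flowOut, heq _ (e.mem_source.2 ?_)]
    · ring
    · rw [hσ.proj _ hq.1.1]
      exact hq.1.2
  have hGK : flowOut ψ σ ∘ K =ᶠ[nhds a] id := by
    have hN1 : ∀ᶠ b in nhds a, φ (μ b) ∈ O :=
      hφμsm.continuousAt.eventually_mem (by rw [hφμ]; exact hσ.isOpen.mem_nhds hpO)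
    have hN2 : ∀ᶠ b in nhds a, μ b ∈ φ.source ∩ e.baseSet :=
      (hp.smooth_proj a).continuousAt.eventually_mem
        (((isOpen_extChartAt_source x₀).inter e.open_baseSet).mem_nhds
          (by rw [hμa]; exact ⟨φ.map_target hyφ, he⟩))
    filter_upwards [hN1, hN2] with b hb1 hb2
    have hproj : μ (σ (φ (μ b))) = μ b := by rw [hσ.proj _ hb1, φ.left_inv hb2.1]
    have hsrc : σ (φ (μ b)) ∈ e.source := e.mem_source.2 (by rw [hproj]; exact hb2.2)
    change ψ ((e b).2 - (e (σ (φ (μ b)))).2) (σ (φ (μ b))) = b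
    refine eq_of_snd_eq e hb2.2 ?_ ?_
    · rw [hp.proj_action, hproj]
    · rw [heq _ hsrc]
      ring
  have hKa : K a = p := hKG.eq_of_nhds
  have d1 : ∀ v : E' × ℝ, tangentMapAt (E := E) (E' := E' × ℝ) K a
      (tangentMapAt (E := E' × ℝ) (E' := E) (flowOut ψ σ) p v) = v := by
    intro v
    have h1 := mfderiv_comp p hKd hG
    rw [hKG.mfderiv_eq, mfderiv_id] at h1
    exact (DFunLike.congr_fun h1 v).symm
  have d2 : ∀ v : E, tangentMapAt (E := E' × ℝ) (E' := E) (flowOut ψ σ) p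
      (tangentMapAt (E := E) (E' := E' × ℝ) K a v) = v := by
    intro v
    have h1 := mfderiv_comp_of_eq (x := a) hG hKd hKa
    rw [hGK.mfderiv_eq, mfderiv_id, hKa] at h1
    exact (DFunLike.congr_fun h1 v).symm
  exact ⟨Function.LeftInverse.injective d1, Function.RightInverse.surjective d2⟩

theorem IsPrincipalRBundle.baseRep_eq (hp : IsPrincipalRBundle E E' ψ μ)
    (hσ : IsLocalSection E E' μ x₀ O σ) (f : V → ℝ) {p : E' × ℝ} (hpO : p.1 ∈ O) :
    baseRep x₀ f p = (f ∘ μ) (flowOut ψ σ p) := by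
  rw [Function.comp_apply, hp.proj_flowOut hσ hpO, baseRep]

theorem IsLocalSection.contDiffOn_baseRep [IsManifold 𝓘(ℝ, E') ∞ V]
    (hσ : IsLocalSection E E' μ x₀ O σ) {f : V → ℝ} (hf : ContMDiff 𝓘(ℝ, E') 𝓘(ℝ, ℝ) ∞ f) :
    ContDiffOn ℝ ∞ (baseRep x₀ f) (O ×ˢ (Set.univ : Set ℝ)) := by
  rw [← contMDiffOn_iff_contDiffOn]
  refine hf.comp_contMDiffOn (f := fun p : E' × ℝ => (extChartAt 𝓘(ℝ, E') x₀).symm p.1) ?_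
  exact (contMDiffOn_extChartAt_symm x₀).comp contDiff_fst.contMDiff.contMDiffOn
    (fun p hp => hσ.subset hp.1)

theorem IsPrincipalRBundle.fderiv_baseRep (hp : IsPrincipalRBundle E E' ψ μ)
    (hσ : IsLocalSection E E' μ x₀ O σ) {f : V → ℝ} (hf : ContMDiff 𝓘(ℝ, E') 𝓘(ℝ, ℝ) ∞ f)
    {p : E' × ℝ} (hpO : p.1 ∈ O) (w : E' × ℝ) :
    fderiv ℝ (baseRep x₀ f) p w = dFun (f ∘ μ) (flowOut ψ σ p)
      (tangentMapAt (E := E' × ℝ) (E' := E) (flowOut ψ σ) p w) := by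
  have h1 : MDifferentiableAt 𝓘(ℝ, E) 𝓘(ℝ, ℝ) (f ∘ μ) (flowOut ψ σ p) :=
    ((hf.comp hp.smooth_proj) _).mdifferentiableAt (by simp)
  have h2 := mfderiv_comp p h1 (hp.mdifferentiableAt_flowOut hσ hpO)
  have h3 : (f ∘ μ) ∘ flowOut ψ σ =ᶠ[nhds p] baseRep x₀ f := by
    filter_upwards [hσ.isOpen_prod.mem_nhds ⟨hpO, trivial⟩] with q hq
    exact (hp.baseRep_eq hσ f hq.1).symm
  rw [h3.mfderiv_eq, mfderiv_eq_fderiv] at h2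
  exact DFunLike.congr_fun h2 w

theorem fderiv_baseRep_invariant (x₀ : V) (f : V → ℝ) (y : E') (s : ℝ) :
    fderiv ℝ (baseRep x₀ f) (y, s) = fderiv ℝ (baseRep x₀ f) (y, 0) := by
  have h := fderiv_comp_add_right (𝕜 := ℝ) (f := baseRep x₀ f) (x := (y, 0)) ((0, s) : E' × ℝ)
  have h2 : (fun q : E' × ℝ => baseRep x₀ f (q + (0, s))) = baseRep x₀ f := by
    funext q
    simp [baseRep]
  rw [h2] at h
  rw [h]
  simp

end LocalModel

/-! ### The symplectic form in the parametrization -/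

section SymplecticModel

variable {E : Type*} [NormedAddCommGroup E] [NormedSpace ℝ E]
  {A : Type*} [TopologicalSpace A] [ChartedSpace E A]
  {E' : Type*} [NormedAddCommGroup E'] [NormedSpace ℝ E']
  {V : Type*} [TopologicalSpace V] [ChartedSpace E' V]
  {Ω : DiffForm E A 2} {ψ : ℝ → A → A} {μ : A → V} {x₀ : V} {O : Set E'} {σ : E' → A}

theorem IsSymplecticPrincipalRBundle.contDiffOn_modelForm
    [FiniteDimensional ℝ E] [FiniteDimensional ℝ E'] [IsManifold 𝓘(ℝ, E) ∞ A]
    (hμ : IsSymplecticPrincipalRBundle (E' := E') Ω ψ μ) (hσ : IsLocalSection E E' μ x₀ O σ) :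
    ContDiffOn ℝ ∞ (modelForm Ω ψ σ) (O ×ˢ (Set.univ : Set ℝ)) :=
  hμ.symplectic.smooth.pullback hσ.isOpen_prod (hμ.principal.contMDiffOn_flowOut hσ)

theorem IsSymplecticPrincipalRBundle.extDeriv_modelForm [IsManifold 𝓘(ℝ, E) ∞ A]
    (hμ : IsSymplecticPrincipalRBundle (E' := E') Ω ψ μ) (hσ : IsLocalSection E E' μ x₀ O σ)
    {p : E' × ℝ} (hpO : p.1 ∈ O) : extDeriv (modelForm Ω ψ σ) p = 0 :=
  hμ.symplectic.closed.pullback hμ.symplectic.smooth hσ.isOpen_prod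
    (hμ.principal.contMDiffOn_flowOut hσ) ⟨hpO, trivial⟩

theorem IsSymplecticPrincipalRBundle.modelForm_nondegenerate [IsManifold 𝓘(ℝ, E') ∞ V]
    (hμ : IsSymplecticPrincipalRBundle (E' := E') Ω ψ μ) (hσ : IsLocalSection E E' μ x₀ O σ)
    {p : E' × ℝ} (hpO : p.1 ∈ O) (v : E' × ℝ) (hv : ∀ w, modelForm Ω ψ σ p ![v, w] = 0) :
    v = 0 := by
  obtain ⟨hinj, hsurj⟩ := hμ.principal.bijective_tangentMapAt_flowOut hσ hpO
  apply hinj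
  rw [map_zero]
  refine hμ.symplectic.nondegenerate (flowOut ψ σ p) _ fun w => ?_
  obtain ⟨w, rfl⟩ := hsurj w
  rw [← modelForm_apply, hv]

/-- Translation by `s` in the parameter space corresponds to `ψ_s` on `A`, which preserves `Ω`. -/
theorem IsSymplecticPrincipalRBundle.modelForm_invariant
    (hμ : IsSymplecticPrincipalRBundle (E' := E') Ω ψ μ) (hσ : IsLocalSection E E' μ x₀ O σ)
    {y : E'} (hy : y ∈ O) (s : ℝ) : modelForm Ω ψ σ (y, s) = modelForm Ω ψ σ (y, 0) := by
  have hp := hμ.principal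
  have h1 : ∀ q : E' × ℝ, flowOut ψ σ (q + (0, s)) = ψ s (flowOut ψ σ q) := by
    intro q
    simp [flowOut, ← hp.add_action, add_comm]
  have hG0 := hp.mdifferentiableAt_flowOut hσ (p := (y, 0)) hy
  have hGs := hp.mdifferentiableAt_flowOut hσ (p := (y, s)) hy
  have hψ : MDifferentiableAt 𝓘(ℝ, E) 𝓘(ℝ, E) (ψ s) (flowOut ψ σ (y, 0)) :=
    (hp.contMDiff_action s _).mdifferentiableAt (by simp)
  have hτ : HasMFDerivAt 𝓘(ℝ, E' × ℝ) 𝓘(ℝ, E' × ℝ) (fun q : E' × ℝ => q + (0, s)) (y, 0)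
      (ContinuousLinearMap.id ℝ (E' × ℝ)) :=
    ((hasFDerivAt_id _).add_const _).hasMFDerivAt
  have hτ0 : ((y, 0) : E' × ℝ) + (0, s) = (y, s) := by simp
  have hGs' : MDifferentiableAt 𝓘(ℝ, E' × ℝ) 𝓘(ℝ, E) (flowOut ψ σ) ((y, 0) + (0, s)) := by
    rw [hτ0]; exact hGs
  have hcomp := hGs'.hasMFDerivAt.comp ((y, 0) : E' × ℝ) hτ
  have hcomp2 := hψ.hasMFDerivAt.comp ((y, 0) : E' × ℝ) hG0.hasMFDerivAt
  have hfun : flowOut ψ σ ∘ (fun q : E' × ℝ => q + (0, s)) = ψ s ∘ flowOut ψ σ := funext h1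
  rw [hfun] at hcomp
  have hT := hasMFDerivAt_unique hcomp hcomp2
  have hT' : ∀ v : E' × ℝ, tangentMapAt (E := E' × ℝ) (E' := E) (flowOut ψ σ) (y, s) v =
      tangentMapAt (ψ s) (flowOut ψ σ (y, 0))
        (tangentMapAt (E := E' × ℝ) (E' := E) (flowOut ψ σ) (y, 0) v) := by
    intro v
    rw [← hτ0]
    exact DFunLike.congr_fun hT v
  ext v
  have hv : v = ![v 0, v 1] := by ext i <;> fin_cases i <;> rfl
  rw [hv, modelForm_apply, modelForm_apply, hT', hT']
  have hinv := congrFun (hμ.action_symplectic s) (flowOut ψ σ (y, 0))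
  have hpt : flowOut ψ σ (y, s) = ψ s (flowOut ψ σ (y, 0)) := by rw [← h1, hτ0]
  rw [← hinv]
  unfold DiffForm.pullback
  rw [ContinuousAlternatingMap.compContinuousLinearMap_apply, hpt]
  congr 1
  ext i
  fin_cases i <;> rfl

theorem IsSymplecticPrincipalRBundle.symplecticBracket_flowOut
    [FiniteDimensional ℝ E] [FiniteDimensional ℝ E'] [IsManifold 𝓘(ℝ, E') ∞ V]
    (hμ : IsSymplecticPrincipalRBundle (E' := E') Ω ψ μ) (hσ : IsLocalSection E E' μ x₀ O σ)
    {f g : V → ℝ} (hf : ContMDiff 𝓘(ℝ, E') 𝓘(ℝ, ℝ) ∞ f) (hg : ContMDiff 𝓘(ℝ, E') 𝓘(ℝ, ℝ) ∞ g)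
    {p : E' × ℝ} (hpO : p.1 ∈ O) :
    symplecticBracket Ω (f ∘ μ) (g ∘ μ) (flowOut ψ σ p) =
      localBracket (modelForm Ω ψ σ) (baseRep x₀ f) (baseRep x₀ g) p := by
  have hp := hμ.principal
  -- Naturality of Hamiltonian fields: since the tangent map is onto, the defining equation need
  -- only be tested on images of model vectors.
  have hX : hamiltonianField Ω (g ∘ μ) (flowOut ψ σ p) =
      tangentMapAt (E := E' × ℝ) (E' := E) (flowOut ψ σ) p
        (localHam (modelForm Ω ψ σ) (baseRep x₀ g) p) := by
    refine hamiltonianField_eq (hμ.symplectic.nondegenerate _) fun w => ?_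
    obtain ⟨w, rfl⟩ := (hp.bijective_tangentMapAt_flowOut hσ hpO).2 w
    rw [← modelForm_apply, localHam_spec (hμ.modelForm_nondegenerate hσ hpO),
      hp.fderiv_baseRep hσ hg hpO]
  rw [symplecticBracket, hX, ← hp.fderiv_baseRep hσ hf hpO, localBracket]

theorem IsSymplecticPrincipalRBundle.localBracket_invariant
    (hμ : IsSymplecticPrincipalRBundle (E' := E') Ω ψ μ) (hσ : IsLocalSection E E' μ x₀ O σ)
    (f g : V → ℝ) {y : E'} (hy : y ∈ O) (s : ℝ) :
    localBracket (modelForm Ω ψ σ) (baseRep x₀ f) (baseRep x₀ g) (y, s) =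
      localBracket (modelForm Ω ψ σ) (baseRep x₀ f) (baseRep x₀ g) (y, 0) := by
  rw [localBracket, localBracket, localHam, localHam, hμ.modelForm_invariant hσ hy s,
    fderiv_baseRep_invariant x₀ f, fderiv_baseRep_invariant x₀ g]

end SymplecticModel

/-! ### The induced Poisson bracket on the base -/

section Derivation

variable {E : Type*} [NormedAddCommGroup E] [NormedSpace ℝ E]
  {M : Type*} [TopologicalSpace M] [ChartedSpace E M] {f g : M → ℝ} {x : M}

theorem dFun_add (hf : MDifferentiableAt 𝓘(ℝ, E) 𝓘(ℝ, ℝ) f x)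
    (hg : MDifferentiableAt 𝓘(ℝ, E) 𝓘(ℝ, ℝ) g x) (v : E) :
    dFun (f + g) x v = dFun f x v + dFun g x v :=
  DFunLike.congr_fun (hf.hasMFDerivAt.add hg.hasMFDerivAt).mfderiv v

theorem dFun_smul (hf : MDifferentiableAt 𝓘(ℝ, E) 𝓘(ℝ, ℝ) f x) (c : ℝ) (v : E) :
    dFun (c • f) x v = c * dFun f x v :=
  DFunLike.congr_fun (hf.hasMFDerivAt.const_smul c).mfderiv v

theorem dFun_mul (hf : MDifferentiableAt 𝓘(ℝ, E) 𝓘(ℝ, ℝ) f x)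
    (hg : MDifferentiableAt 𝓘(ℝ, E) 𝓘(ℝ, ℝ) g x) (v : E) :
    dFun (f * g) x v = f x * dFun g x v + g x * dFun f x v :=
  DFunLike.congr_fun (hf.hasMFDerivAt.mul hg.hasMFDerivAt).mfderiv v

end Derivation

section BaseBracket

variable {E : Type*} [NormedAddCommGroup E] [NormedSpace ℝ E]
  {A : Type*} [TopologicalSpace A] [ChartedSpace E A]
  {E' : Type*} [NormedAddCommGroup E'] [NormedSpace ℝ E']
  {V : Type*} [TopologicalSpace V] [ChartedSpace E' V]
  {Ω : DiffForm E A 2} {ψ : ℝ → A → A} {μ : A → V}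

theorem IsPrincipalRBundle.surjective_proj (hp : IsPrincipalRBundle E E' ψ μ) :
    Function.Surjective μ := by
  intro v
  obtain ⟨e, he, -⟩ := hp.locally_trivial v
  exact ⟨e.toOpenPartialHomeomorph.symm (v, 0), e.proj_symm_apply' he⟩

/-- The bracket of functions on the base, computed at arbitrary points of the fibres. -/
def baseBracket (Ω : DiffForm E A 2) (hsurj : Function.Surjective μ) (f g : V → ℝ) : V → ℝ :=
  fun v => symplecticBracket Ω (f ∘ μ) (g ∘ μ) (Function.surjInv hsurj v)

variable [FiniteDimensional ℝ E] [FiniteDimensional ℝ E'] [IsManifold 𝓘(ℝ, E') ∞ V]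

/-- Points of one fibre lie on one orbit, hence share the coordinate `y` in a common
parametrization, and the model bracket ignores `s`. This makes the choice of `Function.surjInv` in
`baseBracket` harmless. -/
theorem IsSymplecticPrincipalRBundle.symplecticBracket_eq_of_proj_eq
    (hμ : IsSymplecticPrincipalRBundle (E' := E') Ω ψ μ) {f g : V → ℝ}
    (hf : ContMDiff 𝓘(ℝ, E') 𝓘(ℝ, ℝ) ∞ f) (hg : ContMDiff 𝓘(ℝ, E') 𝓘(ℝ, ℝ) ∞ g) {a b : A}
    (h : μ a = μ b) :
    symplecticBracket Ω (f ∘ μ) (g ∘ μ) a = symplecticBracket Ω (f ∘ μ) (g ∘ μ) b := by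
  obtain ⟨O, σ, hσ, hy⟩ := hμ.principal.exists_isLocalSection (μ a)
  have key : ∀ c, μ c = μ a → symplecticBracket Ω (f ∘ μ) (g ∘ μ) c =
      localBracket (modelForm Ω ψ σ) (baseRep (μ a) f) (baseRep (μ a) g)
        (extChartAt 𝓘(ℝ, E') (μ a) (μ a), 0) := by
    intro c hc
    obtain ⟨s, rfl⟩ := hμ.principal.exists_action_eq
      (a := σ (extChartAt 𝓘(ℝ, E') (μ a) (μ a))) (b := c) (by
        rw [hσ.proj _ hy, extChartAt_to_inv, hc])
    rw [← hμ.localBracket_invariant hσ f g hy s, ← hμ.symplecticBracket_flowOut hσ hf hg hy]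
    rfl
  rw [key a rfl, key b h.symm]

theorem IsSymplecticPrincipalRBundle.baseBracket_proj
    (hμ : IsSymplecticPrincipalRBundle (E' := E') Ω ψ μ) {f g : V → ℝ}
    (hf : ContMDiff 𝓘(ℝ, E') 𝓘(ℝ, ℝ) ∞ f) (hg : ContMDiff 𝓘(ℝ, E') 𝓘(ℝ, ℝ) ∞ g) (a : A) :
    symplecticBracket Ω (f ∘ μ) (g ∘ μ) a =
      baseBracket Ω hμ.principal.surjective_proj f g (μ a) :=
  hμ.symplecticBracket_eq_of_proj_eq hf hg (Function.surjInv_eq _ _).symm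

theorem IsSymplecticPrincipalRBundle.baseRep_baseBracket
    (hμ : IsSymplecticPrincipalRBundle (E' := E') Ω ψ μ) {x₀ : V} {O : Set E'} {σ : E' → A}
    (hσ : IsLocalSection E E' μ x₀ O σ) {f g : V → ℝ}
    (hf : ContMDiff 𝓘(ℝ, E') 𝓘(ℝ, ℝ) ∞ f) (hg : ContMDiff 𝓘(ℝ, E') 𝓘(ℝ, ℝ) ∞ g) {p : E' × ℝ}
    (hp : p.1 ∈ O) :
    baseRep x₀ (baseBracket Ω hμ.principal.surjective_proj f g) p =
      localBracket (modelForm Ω ψ σ) (baseRep x₀ f) (baseRep x₀ g) p := by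
  rw [← hμ.symplecticBracket_flowOut hσ hf hg hp, hμ.baseBracket_proj hf hg,
    hμ.principal.baseRep_eq hσ _ hp]
  rfl

variable [IsManifold 𝓘(ℝ, E) ∞ A]

theorem IsSymplecticPrincipalRBundle.contMDiff_baseBracket
    (hμ : IsSymplecticPrincipalRBundle (E' := E') Ω ψ μ) {f g : V → ℝ}
    (hf : ContMDiff 𝓘(ℝ, E') 𝓘(ℝ, ℝ) ∞ f) (hg : ContMDiff 𝓘(ℝ, E') 𝓘(ℝ, ℝ) ∞ g) :
    ContMDiff 𝓘(ℝ, E') 𝓘(ℝ, ℝ) ∞ (baseBracket Ω hμ.principal.surjective_proj f g) := by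
  intro x₀
  obtain ⟨O, σ, hσ, hy⟩ := hμ.principal.exists_isLocalSection x₀
  set φ := extChartAt 𝓘(ℝ, E') x₀ with hφ
  have h1 : ContDiffOn ℝ ∞ (localBracket (modelForm Ω ψ σ) (baseRep x₀ f) (baseRep x₀ g))
      (O ×ˢ (Set.univ : Set ℝ)) :=
    contDiffOn_localBracket hσ.isOpen_prod (hμ.contDiffOn_modelForm hσ)
      (fun p hp => hμ.modelForm_nondegenerate hσ hp.1) (hσ.contDiffOn_baseRep hf)
      (hσ.contDiffOn_baseRep hg)
  have h2 : ContMDiffAt 𝓘(ℝ, E') 𝓘(ℝ, E' × ℝ) ∞ (fun v => (φ v, (0 : ℝ))) x₀ :=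
    contMDiffAt_extChartAt.prodMk_space contMDiffAt_const
  have h3 := (h1.contDiffAt (hσ.isOpen_prod.mem_nhds (x := (φ x₀, (0 : ℝ)))
    ⟨hy, trivial⟩)).contMDiffAt.comp x₀ h2
  refine h3.congr_of_eventuallyEq ?_
  have h4 : ∀ᶠ v in nhds x₀, φ v ∈ O :=
    (continuousAt_extChartAt x₀).eventually_mem (hσ.isOpen.mem_nhds hy)
  filter_upwards [h4, extChartAt_source_mem_nhds (I := 𝓘(ℝ, E')) x₀] with v hv hv'
  rw [Function.comp_apply, ← hμ.baseRep_baseBracket hσ hf hg (p := (φ v, (0 : ℝ))) hv, baseRep]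
  change _ = baseBracket Ω _ f g (φ.symm (φ v))
  rw [φ.left_inv hv']

theorem IsSymplecticPrincipalRBundle.baseBracket_jacobi
    (hμ : IsSymplecticPrincipalRBundle (E' := E') Ω ψ μ) {f g k : V → ℝ}
    (hf : ContMDiff 𝓘(ℝ, E') 𝓘(ℝ, ℝ) ∞ f) (hg : ContMDiff 𝓘(ℝ, E') 𝓘(ℝ, ℝ) ∞ g)
    (hk : ContMDiff 𝓘(ℝ, E') 𝓘(ℝ, ℝ) ∞ k) (v : V) :
    baseBracket Ω hμ.principal.surjective_proj f
        (baseBracket Ω hμ.principal.surjective_proj g k) v +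
      baseBracket Ω hμ.principal.surjective_proj g
        (baseBracket Ω hμ.principal.surjective_proj k f) v +
      baseBracket Ω hμ.principal.surjective_proj k
        (baseBracket Ω hμ.principal.surjective_proj f g) v = 0 := by
  obtain ⟨O, σ, hσ, hy⟩ := hμ.principal.exists_isLocalSection v
  set p : E' × ℝ := (extChartAt 𝓘(ℝ, E') v v, 0) with hpdef
  have key : ∀ {f g k : V → ℝ}, ContMDiff 𝓘(ℝ, E') 𝓘(ℝ, ℝ) ∞ f →
      ContMDiff 𝓘(ℝ, E') 𝓘(ℝ, ℝ) ∞ g → ContMDiff 𝓘(ℝ, E') 𝓘(ℝ, ℝ) ∞ k →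
      baseBracket Ω hμ.principal.surjective_proj f
        (baseBracket Ω hμ.principal.surjective_proj g k) v =
      localBracket (modelForm Ω ψ σ) (baseRep v f)
        (localBracket (modelForm Ω ψ σ) (baseRep v g) (baseRep v k)) p := by
    intro f g k hf hg hk
    have h1 := hμ.baseRep_baseBracket hσ hf (hμ.contMDiff_baseBracket hg hk) (p := p) hy
    rw [baseRep, hpdef, extChartAt_to_inv, ← hpdef] at h1
    rw [h1, localBracket, localBracket, localHam, localHam]
    -- The outer bracket sees only the derivative at `p` of the inner one, so equality of germs is
    -- enough.
    have h2 : baseRep v (baseBracket Ω hμ.principal.surjective_proj g k) =ᶠ[nhds p]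
        localBracket (modelForm Ω ψ σ) (baseRep v g) (baseRep v k) := by
      filter_upwards [hσ.isOpen_prod.mem_nhds (x := p) ⟨hy, trivial⟩] with q hq
      exact hμ.baseRep_baseBracket hσ hg hk hq.1
    rw [h2.fderiv_eq]
  rw [key hf hg hk, key hg hk hf, key hk hf hg]
  exact localBracket_jacobi hσ.isOpen_prod (hμ.contDiffOn_modelForm hσ)
    (fun p hp => hμ.modelForm_nondegenerate hσ hp.1) (hσ.contDiffOn_baseRep hf)
    (hσ.contDiffOn_baseRep hg) (hσ.contDiffOn_baseRep hk) ⟨hy, trivial⟩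
    (hμ.extDeriv_modelForm hσ hy)

omit [IsManifold 𝓘(ℝ, E) ∞ A] [IsManifold 𝓘(ℝ, E') ∞ V] [FiniteDimensional ℝ E'] in
theorem IsSymplecticPrincipalRBundle.baseBracket_skew
    (hμ : IsSymplecticPrincipalRBundle (E' := E') Ω ψ μ) (f g : V → ℝ) (v : V) :
    baseBracket Ω hμ.principal.surjective_proj f g v =
      -baseBracket Ω hμ.principal.surjective_proj g f v :=
  symplecticBracket_skew (hμ.symplectic.nondegenerate _) _ _

/-- The Poisson bracket induced on the base of a symplectic principal `ℝ`-bundle. -/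
def IsSymplecticPrincipalRBundle.poissonBracket
    (hμ : IsSymplecticPrincipalRBundle (E' := E') Ω ψ μ) : PoissonBracket E' V :=
  let b : C^∞⟮𝓘(ℝ, E'), V; ℝ⟯ → C^∞⟮𝓘(ℝ, E'), V; ℝ⟯ → C^∞⟮𝓘(ℝ, E'), V; ℝ⟯ := fun f g =>
    ⟨baseBracket Ω hμ.principal.surjective_proj f g,
      hμ.contMDiff_baseBracket f.contMDiff g.contMDiff⟩
  have hb : ∀ f g v, b f g v = baseBracket Ω hμ.principal.surjective_proj f g v :=
    fun _ _ _ => rfl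
  have hd : ∀ (f : C^∞⟮𝓘(ℝ, E'), V; ℝ⟯) (a : A),
      MDifferentiableAt 𝓘(ℝ, E) 𝓘(ℝ, ℝ) (f ∘ μ) a := fun f a =>
    ((f.contMDiff.comp hμ.principal.smooth_proj) a).mdifferentiableAt (by simp)
  have hskew : ∀ f g, b f g = -b g f := fun f g =>
    ContMDiffMap.ext fun v => hμ.baseBracket_skew f g v
  -- In the first slot the bracket is differentiation along a fixed vector, so linearity and the
  -- Leibniz rule are those of `d`; skew-symmetry moves them to the second slot.
  have hadd : ∀ f f' g, b (f + f') g = b f g + b f' g := fun f f' g =>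
    ContMDiffMap.ext fun _ => dFun_add (hd f _) (hd f' _) _
  have hsmul : ∀ (c : ℝ) f g, b (c • f) g = c • b f g := fun c f g =>
    ContMDiffMap.ext fun _ => dFun_smul (hd f _) c _
  have hmul : ∀ f f' g, b (f * f') g = f * b f' g + f' * b f g := fun f f' g =>
    ContMDiffMap.ext fun v => by
      have h := dFun_mul (hd f (Function.surjInv hμ.principal.surjective_proj v)) (hd f' _)
        (hamiltonianField Ω (g ∘ μ) (Function.surjInv hμ.principal.surjective_proj v))
      simp only [Function.comp_apply, Function.surjInv_eq] at h
      exact h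
  { bracket := LinearMap.mk₂ ℝ b hadd hsmul
      (fun f g g' => by
        rw [hskew f, hadd, hskew g, hskew g']
        abel)
      (fun c f g => by rw [hskew f, hsmul, hskew g, smul_neg, neg_neg])
    skew := fun f g => hskew f g
    leibniz := fun f g k => by
      simp only [LinearMap.mk₂_apply]
      rw [hskew f, hmul, hskew g, hskew k]
      ring
    jacobi := fun f g k => ContMDiffMap.ext fun v =>
      hμ.baseBracket_jacobi f.contMDiff g.contMDiff k.contMDiff v }

theorem IsSymplecticPrincipalRBundle.poissonBracket_apply
    (hμ : IsSymplecticPrincipalRBundle (E' := E') Ω ψ μ) (f g : C^∞⟮𝓘(ℝ, E'), V; ℝ⟯) (a : A) :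
    hμ.poissonBracket.bracket f g (μ a) = symplecticBracket Ω (f ∘ μ) (g ∘ μ) a :=
  (hμ.baseBracket_proj f.contMDiff g.contMDiff a).symm

end BaseBracket

/-! ### Tangent vectors along a section -/

section FlowOutTangent

variable {E : Type*} [NormedAddCommGroup E] [NormedSpace ℝ E]
  {A : Type*} [TopologicalSpace A] [ChartedSpace E A]
  {E' : Type*} [NormedAddCommGroup E'] [NormedSpace ℝ E']
  {V : Type*} [TopologicalSpace V] [ChartedSpace E' V]
  {Ω : DiffForm E A 2} {ψ : ℝ → A → A} {μ : A → V} {x₀ : V} {O : Set E'} {σ : E' → A}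

theorem IsPrincipalRBundle.flowOut_zero (hp : IsPrincipalRBundle E E' ψ μ) (σ : E' → A) (y : E') :
    flowOut ψ σ (y, 0) = σ y :=
  hp.zero_action _

theorem IsPrincipalRBundle.tangentMapAt_flowOut_horizontal (hp : IsPrincipalRBundle E E' ψ μ)
    (hσ : IsLocalSection E E' μ x₀ O σ) {y : E'} (hy : y ∈ O) (u : E') :
    tangentMapAt (E := E' × ℝ) (E' := E) (flowOut ψ σ) (y, 0) (u, 0) =
      tangentMapAt (E := E') (E' := E) σ y u := by
  have hι : HasMFDerivAt 𝓘(ℝ, E') 𝓘(ℝ, E' × ℝ) (fun y : E' => (y, (0 : ℝ))) y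
      (ContinuousLinearMap.inl ℝ E' ℝ) :=
    (ContinuousLinearMap.inl ℝ E' ℝ).hasFDerivAt.hasMFDerivAt
  have h := (hp.mdifferentiableAt_flowOut hσ (p := (y, 0)) hy).hasMFDerivAt.comp y hι
  have hfun : flowOut ψ σ ∘ (fun y : E' => (y, (0 : ℝ))) = σ := funext (hp.flowOut_zero σ)
  rw [hfun] at h
  exact (DFunLike.congr_fun h.mfderiv u).symm

theorem IsPrincipalRBundle.tangentMapAt_flowOut_vertical (hp : IsPrincipalRBundle E E' ψ μ)
    (hσ : IsLocalSection E E' μ x₀ O σ) {y : E'} (hy : y ∈ O) :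
    tangentMapAt (E := E' × ℝ) (E' := E) (flowOut ψ σ) (y, 0) (0, 1) =
      infGenerator ψ (σ y) := by
  have hι : HasMFDerivAt 𝓘(ℝ, ℝ) 𝓘(ℝ, E' × ℝ) (fun s : ℝ => (y, s)) 0
      (ContinuousLinearMap.inr ℝ E' ℝ) :=
    (hasFDerivAt_prodMk_right y 0).hasMFDerivAt
  have h := (hp.mdifferentiableAt_flowOut hσ (p := (y, 0)) hy).hasMFDerivAt.comp (0 : ℝ) hι
  exact (DFunLike.congr_fun h.mfderiv (1 : ℝ)).symm

end FlowOutTangent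

/-! ### Hamiltonian sections and their cosymplectic structures -/

section Section

variable {E : Type*} [NormedAddCommGroup E] [NormedSpace ℝ E]
  {A : Type*} [TopologicalSpace A] [ChartedSpace E A]
  {E' : Type*} [NormedAddCommGroup E'] [NormedSpace ℝ E']
  {V : Type*} [TopologicalSpace V] [ChartedSpace E' V] [IsManifold 𝓘(ℝ, E') ∞ V]
  {Ω : DiffForm E A 2} {ψ : ℝ → A → A} {μ : A → V} {h : V → A}

theorem IsHamiltonianSection.isLocalSection (hh : IsHamiltonianSection E E' μ h) (x₀ : V) :
    IsLocalSection E E' μ x₀ (extChartAt 𝓘(ℝ, E') x₀).target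
      (h ∘ (extChartAt 𝓘(ℝ, E') x₀).symm) where
  isOpen := isOpen_extChartAt_target x₀
  subset := subset_rfl
  smooth := hh.smooth.comp_contMDiffOn (contMDiffOn_extChartAt_symm x₀)
  proj := fun _ _ => hh.section_eq _

theorem mdifferentiableAt_extChartAt_symm (x₀ : V) {y : E'}
    (hy : y ∈ (extChartAt 𝓘(ℝ, E') x₀).target) :
    MDifferentiableAt 𝓘(ℝ, E') 𝓘(ℝ, E') (extChartAt 𝓘(ℝ, E') x₀).symm y :=
  ((contMDiffOn_extChartAt_symm (n := ∞) x₀).contMDiffAt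
    ((isOpen_extChartAt_target x₀).mem_nhds hy)).mdifferentiableAt (by simp)

theorem IsHamiltonianSection.tangentMapAt_comp (hh : IsHamiltonianSection E E' μ h) (x₀ : V)
    {y : E'} (hy : y ∈ (extChartAt 𝓘(ℝ, E') x₀).target) (u : E') :
    tangentMapAt (E := E') (E' := E) (h ∘ (extChartAt 𝓘(ℝ, E') x₀).symm) y u =
      tangentMapAt (E := E') (E' := E) h ((extChartAt 𝓘(ℝ, E') x₀).symm y)
        (tangentMapAt (E := E') (E' := E') (M := E') (N := V) (extChartAt 𝓘(ℝ, E') x₀).symm y u) :=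
  DFunLike.congr_fun (mfderiv_comp y ((hh.smooth _).mdifferentiableAt (by simp))
    (mdifferentiableAt_extChartAt_symm x₀ hy)) u

theorem surjective_tangentMapAt_extChartAt_symm (x : V) :
    Function.Surjective (tangentMapAt (E := E') (E' := E') (M := E') (N := V)
      (extChartAt 𝓘(ℝ, E') x).symm
      (extChartAt 𝓘(ℝ, E') x x)) := by
  have h1 : MDifferentiableAt 𝓘(ℝ, E') 𝓘(ℝ, E') (extChartAt 𝓘(ℝ, E') x) x :=
    (contMDiffAt_extChartAt (n := ∞)).mdifferentiableAt (by simp)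
  have h2 := mfderiv_comp x (mdifferentiableAt_extChartAt_symm x (mem_extChartAt_target x)) h1
  have h3 : (extChartAt 𝓘(ℝ, E') x).symm ∘ extChartAt 𝓘(ℝ, E') x =ᶠ[nhds x] id := by
    filter_upwards [extChartAt_source_mem_nhds (I := 𝓘(ℝ, E')) x] with v hv
    exact (extChartAt 𝓘(ℝ, E') x).left_inv hv
  rw [h3.mfderiv_eq, mfderiv_id] at h2
  intro w
  exact ⟨mfderiv 𝓘(ℝ, E') 𝓘(ℝ, E') (extChartAt 𝓘(ℝ, E') x) x w, (DFunLike.congr_fun h2 w).symm⟩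

omit [IsManifold 𝓘(ℝ, E') ∞ V] in
theorem omegaH_apply (x : V) (u w : E') :
    omegaH (E' := E') Ω h x ![u, w] = Ω (h x)
      ![tangentMapAt (E := E') (E' := E) h x u, tangentMapAt (E := E') (E' := E) h x w] := by
  unfold omegaH DiffForm.pullback
  rw [ContinuousAlternatingMap.compContinuousLinearMap_apply]
  congr 1
  ext i
  fin_cases i <;> rfl

omit [IsManifold 𝓘(ℝ, E') ∞ V] in
theorem etaH_apply (x : V) (w : E') :
    etaH (E' := E') Ω ψ h x ![w] = -Ω (h x)
      ![infGenerator (E := E) ψ (h x), tangentMapAt (E := E') (E' := E) h x w] := by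
  change -(Ω (h x) (Matrix.vecCons _ _)) = _
  congr 2
  ext i
  fin_cases i <;> rfl

/-- After the chart change `D`, this is the tangent map at time `0` of the parametrization defined
by `h`: horizontal vectors go to the image of `T h`, the vertical one to `Z_μ`. -/
theorem IsHamiltonianSection.bijective_tangent (hh : IsHamiltonianSection E E' μ h)
    (hp : IsPrincipalRBundle E E' ψ μ) (x : V) :
    Function.Bijective fun q : E' × ℝ => tangentMapAt (E := E') (E' := E) h x q.1 +
      q.2 • infGenerator (E := E) ψ (h x) := by
  have hσ := hh.isLocalSection (E := E) x
  set φ := extChartAt 𝓘(ℝ, E') x with hφ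
  have hy : φ x ∈ φ.target := mem_extChartAt_target x
  have hx : φ.symm (φ x) = x := extChartAt_to_inv x
  have hD := surjective_tangentMapAt_extChartAt_symm (E' := E') x
  set D := tangentMapAt (E := E') (E' := E') (M := E') (N := V) φ.symm (φ x) with hDdef
  have key : ∀ u s, tangentMapAt (E := E' × ℝ) (E' := E) (flowOut ψ (h ∘ φ.symm)) (φ x, 0) (u, s) =
      tangentMapAt (E := E') (E' := E) h x (D u) + s • infGenerator (E := E) ψ (h x) := by
    intro u s
    have : ((u, s) : E' × ℝ) = (u, 0) + s • (0, 1) := by simp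
    rw [this, map_add, map_smul, hp.tangentMapAt_flowOut_horizontal hσ hy,
      hp.tangentMapAt_flowOut_vertical hσ hy, hh.tangentMapAt_comp x hy, ← hφ, ← hDdef,
      Function.comp_apply, hx]
  obtain ⟨hinj, hsurj⟩ := hp.bijective_tangentMapAt_flowOut hσ (p := (φ x, 0)) hy
  constructor
  · rintro ⟨u, s⟩ ⟨u', s'⟩ heq
    obtain ⟨u, rfl⟩ := hD u
    obtain ⟨u', rfl⟩ := hD u'
    simp only [← key] at heq
    have := hinj heq
    rw [Prod.mk.injEq] at this
    rw [this.1, this.2]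
  · intro w
    obtain ⟨⟨u, s⟩, rfl⟩ := hsurj w
    exact ⟨(D u, s), (key u s).symm⟩

theorem two_form_sum (α : E [⋀^Fin 2]→L[ℝ] ℝ) (u w z : E) (a b : ℝ) :
    α ![u + a • z, w + b • z] = α ![u, w] + a * α ![z, w] - b * α ![z, u] := by
  have h1 := flat_skew α u z
  have h2 := flat_self α z
  rw [← flat_apply] at h1 h2 ⊢
  simp only [map_add, map_smul, add_apply, smul_apply, smul_eq_mul, h1, h2, flat_apply]
  ring

omit [IsManifold 𝓘(ℝ, E') ∞ V] in
-- The formula linking the symplectic and cosymplectic sides; both nondegeneracy of the pair and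
-- equality of the brackets rest on it.
theorem tangent_sum_apply (x : V) (u w : E') (a b : ℝ) :
    Ω (h x) ![tangentMapAt (E := E') (E' := E) h x u + a • infGenerator (E := E) ψ (h x),
        tangentMapAt (E := E') (E' := E) h x w + b • infGenerator (E := E) ψ (h x)] =
      omegaH (E' := E') Ω h x ![u, w] - a * etaH (E' := E') Ω ψ h x ![w] +
        b * etaH (E' := E') Ω ψ h x ![u] := by
  rw [two_form_sum, omegaH_apply, etaH_apply, etaH_apply]
  ring

theorem IsHamiltonianSection.pairNondegenerate (hh : IsHamiltonianSection E E' μ h)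
    (hμ : IsSymplecticPrincipalRBundle (E' := E') Ω ψ μ) (x : V) :
    PairNondegenerate (omegaH (E' := E') Ω h x) (etaH (E' := E') Ω ψ h x) := by
  intro u a h1 h2
  obtain ⟨hinj, hsurj⟩ := hh.bijective_tangent hμ.principal x
  have h0 : tangentMapAt (E := E') (E' := E) h x u + a • infGenerator (E := E) ψ (h x) = 0 := by
    refine hμ.symplectic.nondegenerate (h x) _ fun w => ?_
    obtain ⟨⟨w, b⟩, rfl⟩ := hsurj w
    simp only
    rw [tangent_sum_apply, h1, h2]
    ring
  have := @hinj (u, a) (0, 0) (by simpa using h0)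
  simpa using this

/-- The local representative of `ω_h`. -/
theorem IsHamiltonianSection.chartRep_omegaH (hh : IsHamiltonianSection E E' μ h)
    (hp : IsPrincipalRBundle E E' ψ μ) (x₀ : V) {y : E'}
    (hy : y ∈ (extChartAt 𝓘(ℝ, E') x₀).target) :
    (omegaH (E' := E') Ω h).chartRep x₀ y =
      (modelForm Ω ψ (h ∘ (extChartAt 𝓘(ℝ, E') x₀).symm) (y, 0)).compContinuousLinearMap
        (ContinuousLinearMap.inl ℝ E' ℝ) := by
  ext v
  have e1 : ((omegaH (E' := E') Ω h).chartRep x₀ y) v = omegaH (E' := E') Ω h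
      ((extChartAt 𝓘(ℝ, E') x₀).symm y)
      ![tangentMapAt (M := E') (N := V) (extChartAt 𝓘(ℝ, E') x₀).symm y (v 0),
        tangentMapAt (M := E') (N := V) (extChartAt 𝓘(ℝ, E') x₀).symm y (v 1)] := by
    rw [DiffForm.chartRep, ContinuousAlternatingMap.compContinuousLinearMap_apply]
    congr 1
    ext i
    fin_cases i <;> rfl
  have e2 : (fun i => ContinuousLinearMap.inl ℝ E' ℝ (v i)) = ![(v 0, 0), (v 1, 0)] := by
    funext i
    fin_cases i <;> rfl
  have hσ := hh.isLocalSection (E := E) x₀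
  rw [e1, ContinuousAlternatingMap.compContinuousLinearMap_apply]
  change _ = modelForm Ω ψ _ (y, 0) (fun i => ContinuousLinearMap.inl ℝ E' ℝ (v i))
  rw [e2, modelForm_apply, omegaH_apply, hp.tangentMapAt_flowOut_horizontal hσ hy,
    hp.tangentMapAt_flowOut_horizontal hσ hy, hp.flowOut_zero, hh.tangentMapAt_comp x₀ hy,
    hh.tangentMapAt_comp x₀ hy]
  rfl

/-- The local representative of `η_h`. -/
theorem IsHamiltonianSection.chartRep_etaH (hh : IsHamiltonianSection E E' μ h)
    (hp : IsPrincipalRBundle E E' ψ μ) (x₀ : V) {y : E'}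
    (hy : y ∈ (extChartAt 𝓘(ℝ, E') x₀).target) (v : Fin 1 → E') :
    (etaH (E' := E') Ω ψ h).chartRep x₀ y v =
      -modelForm Ω ψ (h ∘ (extChartAt 𝓘(ℝ, E') x₀).symm) (y, 0) ![(0, 1), (v 0, 0)] := by
  have e1 : ((etaH (E' := E') Ω ψ h).chartRep x₀ y) v = etaH (E' := E') Ω ψ h
      ((extChartAt 𝓘(ℝ, E') x₀).symm y)
      ![tangentMapAt (M := E') (N := V) (extChartAt 𝓘(ℝ, E') x₀).symm y (v 0)] := by
    rw [DiffForm.chartRep, ContinuousAlternatingMap.compContinuousLinearMap_apply]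
    congr 1
    ext i
    fin_cases i
    rfl
  have hσ := hh.isLocalSection (E := E) x₀
  rw [e1, modelForm_apply, etaH_apply, hp.tangentMapAt_flowOut_horizontal hσ hy,
    hp.tangentMapAt_flowOut_vertical hσ hy, hp.flowOut_zero, hh.tangentMapAt_comp x₀ hy]
  rfl

variable [FiniteDimensional ℝ E] [FiniteDimensional ℝ E'] [IsManifold 𝓘(ℝ, E) ∞ A]

theorem IsHamiltonianSection.contDiffOn_modelForm_zero (hh : IsHamiltonianSection E E' μ h)
    (hμ : IsSymplecticPrincipalRBundle (E' := E') Ω ψ μ) (x₀ : V) :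
    ContDiffOn ℝ ∞ (fun y => modelForm Ω ψ (h ∘ (extChartAt 𝓘(ℝ, E') x₀).symm) (y, 0))
      (extChartAt 𝓘(ℝ, E') x₀).target :=
  (hμ.contDiffOn_modelForm (hh.isLocalSection x₀)).comp
    (ContinuousLinearMap.inl ℝ E' ℝ).contDiff.contDiffOn fun _ hy => ⟨hy, trivial⟩

theorem IsHamiltonianSection.isSmooth_omegaH (hh : IsHamiltonianSection E E' μ h)
    (hμ : IsSymplecticPrincipalRBundle (E' := E') Ω ψ μ) :
    (omegaH (E' := E') Ω h).IsSmooth := by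
  intro x₀
  refine ContDiffOn.congr ?_ fun y hy => hh.chartRep_omegaH hμ.principal x₀ hy
  refine contDiffOn_alternating_of_apply fun v => ?_
  exact (ContinuousAlternatingMap.apply ℝ (E' × ℝ) ℝ
    (fun i => ContinuousLinearMap.inl ℝ E' ℝ (v i))).contDiff.comp_contDiffOn
      (hh.contDiffOn_modelForm_zero hμ x₀)

theorem IsHamiltonianSection.isSmooth_etaH (hh : IsHamiltonianSection E E' μ h)
    (hμ : IsSymplecticPrincipalRBundle (E' := E') Ω ψ μ) :
    (etaH (E' := E') Ω ψ h).IsSmooth := by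
  intro x₀
  refine contDiffOn_alternating_of_apply fun v => ?_
  refine ContDiffOn.congr ?_ fun y hy => hh.chartRep_etaH hμ.principal x₀ hy v
  exact ((ContinuousAlternatingMap.apply ℝ (E' × ℝ) ℝ
    ![(0, 1), (v 0, 0)]).contDiff.comp_contDiffOn (hh.contDiffOn_modelForm_zero hμ x₀)).neg

omit [IsManifold 𝓘(ℝ, E') ∞ V] in
theorem IsSymplecticPrincipalRBundle.differentiableAt_modelForm
    (hμ : IsSymplecticPrincipalRBundle (E' := E') Ω ψ μ) {x₀ : V} {O : Set E'} {σ : E' → A}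
    (hσ : IsLocalSection E E' μ x₀ O σ) {p : E' × ℝ} (hp : p.1 ∈ O) :
    DifferentiableAt ℝ (modelForm Ω ψ σ) p :=
  ((hμ.contDiffOn_modelForm hσ).contDiffAt
    (hσ.isOpen_prod.mem_nhds ⟨hp, trivial⟩)).differentiableAt (by simp)

theorem IsHamiltonianSection.isClosed_omegaH (hh : IsHamiltonianSection E E' μ h)
    (hμ : IsSymplecticPrincipalRBundle (E' := E') Ω ψ μ) :
    (omegaH (E' := E') Ω h).IsClosed := by
  intro x₀ y hy
  have hσ := hh.isLocalSection (E := E) x₀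
  have h1 : (omegaH (E' := E') Ω h).chartRep x₀ =ᶠ[nhds y] fun y =>
      (modelForm Ω ψ (h ∘ (extChartAt 𝓘(ℝ, E') x₀).symm)
        (ContinuousLinearMap.inl ℝ E' ℝ y)).compContinuousLinearMap
        (fderiv ℝ (ContinuousLinearMap.inl ℝ E' ℝ) y) := by
    filter_upwards [(isOpen_extChartAt_target x₀).mem_nhds hy] with z hz
    rw [hh.chartRep_omegaH hμ.principal x₀ hz, ContinuousLinearMap.fderiv]
    rfl
  rw [h1.extDeriv_eq, extDeriv_pullback (r := ∞)
    (hμ.differentiableAt_modelForm hσ (p := ContinuousLinearMap.inl ℝ E' ℝ y) hy)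
    (ContinuousLinearMap.inl ℝ E' ℝ).contDiff.contDiffAt (by
      rw [minSmoothness_of_isRCLikeNormedField]
      exact WithTop.coe_le_coe.2 le_top),
    hμ.extDeriv_modelForm hσ (p := ContinuousLinearMap.inl ℝ E' ℝ y) hy]
  rfl

theorem IsHamiltonianSection.isClosed_etaH (hh : IsHamiltonianSection E E' μ h)
    (hμ : IsSymplecticPrincipalRBundle (E' := E') Ω ψ μ) :
    (etaH (E' := E') Ω ψ h).IsClosed := by
  intro x₀ y hy
  have hσ := hh.isLocalSection (E := E) x₀
  set Θ := modelForm Ω ψ (h ∘ (extChartAt 𝓘(ℝ, E') x₀).symm) with hΘ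
  have hΘd : DifferentiableAt ℝ Θ (y, 0) := hμ.differentiableAt_modelForm hσ (p := (y, 0)) hy
  have hd : DifferentiableAt ℝ ((etaH (E' := E') Ω ψ h).chartRep x₀) y :=
    ((hh.isSmooth_etaH hμ x₀).contDiffAt
      ((isOpen_extChartAt_target x₀).mem_nhds hy)).differentiableAt (by simp)
  -- Infinitesimal invariance, `∂_s Θ = 0`. As in Cartan's formula, `dΘ(∂_s, ·, ·) = 0` then says
  -- that `i_{∂_s} Θ` is closed on the slice `s = 0`.
  have hvert : fderiv ℝ Θ (y, 0) (0, 1) = 0 := by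
    have h1 := (hΘd.hasFDerivAt.comp (0 : ℝ) (hasFDerivAt_prodMk_right y (0 : ℝ))).fderiv
    have h2 : Θ ∘ (fun s : ℝ => (y, s)) = fun _ => Θ (y, 0) :=
      funext fun s => hμ.modelForm_invariant hσ hy s
    rw [h2, fderiv_fun_const] at h1
    exact (DFunLike.congr_fun h1 (1 : ℝ)).symm
  have hder : ∀ (v : Fin 1 → E') (u : E'),
      fderiv ℝ (fun z => (etaH (E' := E') Ω ψ h).chartRep x₀ z v) y u =
        -fderiv ℝ Θ (y, 0) (u, 0) ![(0, 1), (v 0, 0)] := by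
    intro v u
    have h1 : (fun z => (etaH (E' := E') Ω ψ h).chartRep x₀ z v) =ᶠ[nhds y]
        fun z => -Θ (z, 0) ![(0, 1), (v 0, 0)] := by
      filter_upwards [(isOpen_extChartAt_target x₀).mem_nhds hy] with z hz
      exact hh.chartRep_etaH hμ.principal x₀ hz v
    have h2 : HasFDerivAt (fun z => Θ (z, 0))
        (fderiv ℝ Θ (y, 0) ∘L ContinuousLinearMap.inl ℝ E' ℝ) y :=
      hΘd.hasFDerivAt.comp y (hasFDerivAt_prodMk_left y (0 : ℝ))
    have h3 := (h2.continuousAlternatingMap_apply_const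
      (![(0, 1), (v 0, 0)] : Fin 2 → E' × ℝ)).neg.fderiv
    rw [h1.fderiv_eq]
    exact DFunLike.congr_fun h3 u
  ext v
  rw [extDeriv_apply hd]
  simp only [hder]
  refine (Fin.sum_univ_two _).trans ?_
  have h3 := extDeriv_two_apply hΘd (0, 1) (v 0, 0) (v 1, 0)
  rw [hμ.extDeriv_modelForm hσ (p := (y, 0)) hy, hvert] at h3
  have r0 : (0 : Fin 2).removeNth v 0 = v 1 := rfl
  have r1 : (1 : Fin 2).removeNth v 0 = v 0 := rfl
  simp only [r0, r1]
  simp at h3 ⊢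
  linarith

theorem IsHamiltonianSection.isCosymplectic (hh : IsHamiltonianSection E E' μ h)
    (hμ : IsSymplecticPrincipalRBundle (E' := E') Ω ψ μ) :
    IsCosymplectic (E := E') (omegaH Ω h) (etaH Ω ψ h) where
  smooth_two := hh.isSmooth_omegaH hμ
  closed_two := hh.isClosed_omegaH hμ
  smooth_one := hh.isSmooth_etaH hμ
  closed_one := hh.isClosed_etaH hμ
  volume := fun x => (hh.pairNondegenerate hμ x).exists_volume _ _ x

omit [IsManifold 𝓘(ℝ, E) ∞ A] [IsManifold 𝓘(ℝ, E') ∞ V] [FiniteDimensional ℝ E]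
  [FiniteDimensional ℝ E'] in
theorem IsHamiltonianSection.dFun_comp_proj (hh : IsHamiltonianSection E E' μ h)
    (hp : IsPrincipalRBundle E E' ψ μ) {f : V → ℝ} (hf : ContMDiff 𝓘(ℝ, E') 𝓘(ℝ, ℝ) ∞ f) (x : V)
    (w : E') (b : ℝ) :
    dFun (E := E) (f ∘ μ) (h x) (tangentMapAt (E := E') (E' := E) h x w +
      b • infGenerator (E := E) ψ (h x)) = dFun f x w := by
  have hfμ : MDifferentiableAt 𝓘(ℝ, E) 𝓘(ℝ, ℝ) (f ∘ μ) (h x) :=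
    ((hf.comp hp.smooth_proj) _).mdifferentiableAt (by simp)
  have h1 := mfderiv_comp x hfμ ((hh.smooth x).mdifferentiableAt (by simp))
  have hfun : (f ∘ μ) ∘ h = f := funext fun v => congrArg f (hh.section_eq v)
  rw [hfun] at h1
  have hψ : MDifferentiableAt 𝓘(ℝ, ℝ) 𝓘(ℝ, E) (fun s => ψ s (h x)) 0 :=
    ((hp.smooth_action.comp (contMDiff_id.prodMk contMDiff_const)) 0).mdifferentiableAt (by simp)
  -- The chain rule for the orbit is based at `ψ 0 (h x)`, which equals `h x` only by `zero_action`.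
  have hfμ' : MDifferentiableAt 𝓘(ℝ, E) 𝓘(ℝ, ℝ) (f ∘ μ) (ψ 0 (h x)) := by
    rw [hp.zero_action]; exact hfμ
  have h2 := mfderiv_comp (0 : ℝ) hfμ' hψ
  have hfun2 : (f ∘ μ) ∘ (fun s => ψ s (h x)) = fun _ => f (μ (h x)) :=
    funext fun s => congrArg f (hp.proj_action s (h x))
  rw [hfun2, mfderiv_const] at h2
  have e1 : tangentMapAt (E := E) (E' := ℝ) (f ∘ μ) (h x)
      (tangentMapAt (E := E') (E' := E) h x w) = dFun f x w :=
    (DFunLike.congr_fun h1 w).symm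
  have e2 : tangentMapAt (E := E) (E' := ℝ) (f ∘ μ) (h x) (infGenerator (E := E) ψ (h x)) = 0 := by
    have := (DFunLike.congr_fun h2 (1 : ℝ)).symm
    have e3 : tangentMapAt (E := E) (E' := ℝ) (f ∘ μ) (ψ 0 (h x))
        (infGenerator (E := E) ψ (h x)) = 0 := this
    rwa [hp.zero_action] at e3
  rw [dFun, map_add, map_smul, e1, e2, smul_zero, add_zero]

omit [IsManifold 𝓘(ℝ, E) ∞ A] in
-- One solution `(u, a)` of the linear system serves both sides: `u` is the Hamiltonian vector on
-- `V`, and `T h(u) + aZ` the one on `A`. The vertical part does not affect `f ∘ μ`.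
theorem IsHamiltonianSection.cosymplecticBracket_eq (hh : IsHamiltonianSection E E' μ h)
    (hμ : IsSymplecticPrincipalRBundle (E' := E') Ω ψ μ) {f g : V → ℝ}
    (hf : ContMDiff 𝓘(ℝ, E') 𝓘(ℝ, ℝ) ∞ f) (hg : ContMDiff 𝓘(ℝ, E') 𝓘(ℝ, ℝ) ∞ g) (x : V) :
    cosymplecticBracket (E := E') (omegaH Ω h) (etaH Ω ψ h) f g x =
      symplecticBracket Ω (f ∘ μ) (g ∘ μ) (h x) := by
  have hnd := hh.pairNondegenerate hμ x
  obtain ⟨u, a, hu, hη⟩ := hnd.exists_solution (tangentMapAt g x) 0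
  have h1 : cosymplecticHamiltonianField (E := E') (omegaH Ω h) (etaH Ω ψ h) g x = u :=
    cosymplecticHamiltonianField_eq hnd hu hη
  have h2 : hamiltonianField Ω (g ∘ μ) (h x) =
      tangentMapAt (E := E') (E' := E) h x u + a • infGenerator (E := E) ψ (h x) := by
    refine hamiltonianField_eq (hμ.symplectic.nondegenerate _) fun w => ?_
    obtain ⟨⟨w, b⟩, rfl⟩ := (hh.bijective_tangent hμ.principal x).2 w
    simp only
    rw [tangent_sum_apply, hh.dFun_comp_proj hμ.principal hg, hu, hη, mul_zero,
      add_zero]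
    rfl
  rw [cosymplecticBracket, symplecticBracket, h1, h2, hh.dFun_comp_proj hμ.principal hf]

end Section

end RBundle

end

/-- The base `V` of a symplectic principal `ℝ`-bundle carries one Poisson bracket `B` such that
`B` is the (unique) Poisson bracket induced by the bundle and, for every Hamiltonian section `h`,
the pair `(ω_h, η_h)` is a cosymplectic structure whose Poisson bracket exists and is `B`. -/
theorem proposition5p6
    {E : Type*} [NormedAddCommGroup E] [NormedSpace ℝ E] [FiniteDimensional ℝ E]
    {A : Type*} [TopologicalSpace A] [T2Space A] [SecondCountableTopology A]
    [ChartedSpace E A] [IsManifold 𝓘(ℝ, E) ∞ A]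
    {E' : Type*} [NormedAddCommGroup E'] [NormedSpace ℝ E'] [FiniteDimensional ℝ E']
    {V : Type*} [TopologicalSpace V] [T2Space V] [SecondCountableTopology V]
    [ChartedSpace E' V] [IsManifold 𝓘(ℝ, E') ∞ V]
    (Ω : RBundle.DiffForm E A 2) (ψ : ℝ → A → A) (μ : A → V)
    (hμ : RBundle.IsSymplecticPrincipalRBundle (E' := E') Ω ψ μ) :
    ∃ B : RBundle.PoissonBracket E' V,
      (∀ B' : RBundle.PoissonBracket E' V, RBundle.IsInducedPoisson Ω μ B' ↔ B' = B) ∧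
      ∀ h : V → A, RBundle.IsHamiltonianSection E E' μ h →
        RBundle.IsCosymplectic (E := E') (RBundle.omegaH Ω h) (RBundle.etaH Ω ψ h) ∧
        ∀ B' : RBundle.PoissonBracket E' V,
          RBundle.IsCosymplecticPoisson (RBundle.omegaH Ω h) (RBundle.etaH Ω ψ h) B' ↔
            B' = B := by
  -- As `μ` is onto, a bracket on `V` is determined by its values at points `μ a`.
  have ext_bracket : ∀ B' : RBundle.PoissonBracket E' V,
      (∀ f g a, B'.bracket f g (μ a) = hμ.poissonBracket.bracket f g (μ a)) →
        B' = hμ.poissonBracket := by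
    intro B' hB'
    refine RBundle.PoissonBracket.ext (LinearMap.ext₂ fun f g => ContMDiffMap.ext fun v => ?_)
    obtain ⟨a, rfl⟩ := hμ.principal.surjective_proj v
    exact hB' f g a
  refine ⟨hμ.poissonBracket, fun B' => ⟨fun hB' => ?_, ?_⟩, fun h hh =>
    ⟨hh.isCosymplectic hμ, fun B' => ⟨fun hB' => ?_, ?_⟩⟩⟩
  · exact ext_bracket B' fun f g a => by rw [← hB', hμ.poissonBracket_apply]
  · rintro rfl f g a
    rw [hμ.poissonBracket_apply]
  · exact ext_bracket B' fun f g a => by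
      rw [hB', hh.cosymplecticBracket_eq hμ f.contMDiff g.contMDiff, ← hμ.poissonBracket_apply,
        hh.section_eq]
  · rintro rfl f g x
    rw [hh.cosymplecticBracket_eq hμ f.contMDiff g.contMDiff, ← hμ.poissonBracket_apply,
      hh.section_eq]
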